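/- **Setting.** Let $d\in\mathbb N$, let $A$ be a real $d\times d$ matrix with Euclidean operator norm $\|A\|$, let $T>0$, $R_0>0$, and let $\alpha_0,\mu_0$ be Borel probability measures on $\mathbb R^d$ supported in the closed ball $B_{R_0}$ of radius $R_0$ centered at $0$. Set $R:=2R_0e^{\|A\|T}$. For probability measures $\alpha,\mu$ let $\Pi(\alpha,\mu)$ be the set of transport plans between them, and $$W_2^2(\alpha,\mu)=\inf_{\gamma\in\Pi(\alpha,\mu)}\int|x-y|^2\,d\gamma,\qquad \mathrm{OT}_\varepsilon(\alpha,\mu)=\inf_{\gamma\in\Pi(\alpha,\mu)}\Big\{\tfrac12\int|x-y|^2\,d\gamma+\varepsilon H(\gamma\,|\,\alpha\otimes\mu)\Big\},$$ where $H$ is the relative entropy. Consider a $W_2$-continuous curve $t\in[0,T]\mapsto\alpha_t$ of probability measures on $\mathbb R^d$ which takes the value $\alpha_0$ at $t=0$, with $\operatorname{spt}\alpha_t\subset B_R$ for all $t\in[0,T]$, and a measurable family $(\gamma_t)_{t\in[0,T]}$ of measures on $\mathbb R^d\times\mathbb R^d$ such that, for every $f\in C^1([0,T]\times\mathbb R^d)$,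 $$\int_0^T\!\!\int[\partial_tf+Ax\cdot\nabla f]\,\alpha_t(dx)\,dt-\int_0^T\!\!\int Ay\cdot\nabla f(t,x)\,\gamma_t(dx,dy)\,dt=\int f(T,x)\,\alpha_T(dx)-\int f(0,x)\,\alpha_0(dx).$$ The curve $\alpha$ is a *weak solution of the semi-geostrophic system* (with plans $\gamma$) if for a.e. $t\in[0,T]$ the plan $\gamma_t\in\Pi(\alpha_t,\mu_0)$ is optimal for $W_2^2(\alpha_t,\mu_0)$; it is a *weak solution of the entropic semi-geostrophic system with parameter $\varepsilon>0$* (with plans $\gamma$) if for a.e. $t\in[0,T]$ the plan $\gamma_t\in\Pi(\alpha_t,\mu_0)$ is a minimizer for $\mathrm{OT}_\varepsilon(\alpha_t,\mu_0)$. **Theorem.** 1. Let $\varepsilon_n>0$, $\varepsilon_n\to0$, let $\alpha^n$ be a weak solution of the entropic semi-geostrophic system with parameter $\varepsilon_n$, and let $(\alpha_t)_{t\in[0,T]}$ be a curve of probability measures with $\sup_{t\in[0,T]}W_2(\alpha^n_t,\alpha_t)\to0$. Then $\alpha$ is a weak solution of the semi-geostrophic system. 2. In this situation, if $\gamma^n$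 are the plans of $\alpha^n$, then along a subsequence the measures $\gamma^n_t\otimes dt$ converge weakly-$*$ to a measure $\gamma_t\otimes dt$ on $[0,T]\times\mathbb R^d\times\mathbb R^d$, where $\gamma_t$ is an optimal plan between $\alpha_t$ and $\mu_0$ for a.e. $t$, and $\alpha$ is a weak solution of the semi-geostrophic system with plans $\gamma$. 3. For all such data $(\alpha_0,\mu_0)$ the semi-geostrophic system has at least one weak solution on $[0,T]$. -/

import Mathlib

open MeasureTheory ProbabilityTheory Filter Topology Set
open scoped ENNReal

namespace SemiGeo

noncomputable section

/-- The Euclidean space `ℝ^d`. -/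
abbrev Space (d : ℕ) : Type := EuclideanSpace ℝ (Fin d)

variable {d : ℕ}

/-- `m` is concentrated on the closed ball of radius `R` centered at `0`
(equivalently: the support of `m` is contained in that ball, which is closed). -/
def SupportedInBall (m : Measure (Space d)) (R : ℝ) : Prop :=
  m (Metric.closedBall 0 R)ᶜ = 0

/-- The set of transport plans between `a` and `m`: measures on the product whose marginals
are `a` and `m`. -/
def plans (a m : Measure (Space d)) : Set (Measure (Space d × Space d)) :=
  {γ | γ.fst = a ∧ γ.snd = m}

/-- The quadratic cost `∫ |x - y|² dγ(x, y)`. -/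
def quadCost (γ : Measure (Space d × Space d)) : ℝ≥0∞ :=
  ∫⁻ p, ‖p.1 - p.2‖ₑ ^ 2 ∂γ

/-- The squared 2-Wasserstein distance. -/
def W2sq (a m : Measure (Space d)) : ℝ≥0∞ :=
  ⨅ γ ∈ plans a m, quadCost γ

/-- The 2-Wasserstein distance. -/
def W2 (a m : Measure (Space d)) : ℝ≥0∞ :=
  W2sq a m ^ (1 / 2 : ℝ)

/-- `γ` is an optimal transport plan between `a` and `m` for the quadratic cost. -/
def IsOptimalPlan (a m : Measure (Space d)) (γ : Measure (Space d × Space d)) : Prop :=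
  γ ∈ plans a m ∧ quadCost γ = W2sq a m

/-- The entropic transport functional `½ ∫ |x - y|² dγ + ε H(γ | a ⊗ m)`.
For probability measures `InformationTheory.klDiv` is the relative entropy. -/
def entropicCost (ε : ℝ) (a m : Measure (Space d)) (γ : Measure (Space d × Space d)) : ℝ≥0∞ :=
  2⁻¹ * quadCost γ + ENNReal.ofReal ε * InformationTheory.klDiv γ (a.prod m)

/-- The value `OT_ε(a, m)` of the entropic optimal transport problem. -/
def entropicOT (ε : ℝ) (a m : Measure (Space d)) : ℝ≥0∞ :=
  ⨅ γ ∈ plans a m, entropicCost ε a m γ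

/-- `γ` solves the entropic optimal transport problem between `a` and `m`. -/
def IsEntropicPlan (ε : ℝ) (a m : Measure (Space d)) (γ : Measure (Space d × Space d)) : Prop :=
  γ ∈ plans a m ∧ entropicCost ε a m γ = entropicOT ε a m

/-- Continuity for `W2` on `[0, T]` of a curve of probability measures
(only the values of the curve on `[0, T]` are used, here and below). -/
def W2Continuous (T : ℝ) (α : ℝ → ProbabilityMeasure (Space d)) : Prop :=
  ∀ t ∈ Icc 0 T,
    Tendsto (fun s => W2 (α s : Measure (Space d)) (α t)) (𝓝[Icc 0 T] t) (𝓝 0)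

/-- The uniform (in time) 2-Wasserstein distance between two curves on `[0, T]`. -/
def uniformW2 (T : ℝ) (α β : ℝ → ProbabilityMeasure (Space d)) : ℝ≥0∞ :=
  ⨆ t ∈ Icc 0 T, W2 (α t : Measure (Space d)) (β t)

/-- The weak formulation, with velocity field `A (x - ∫ y γ_t(dy | x))`, of the continuity
equation on `[0, T] × ℝ^d` with initial datum `α₀`. The `C¹` functions on the closed slab
`[0, T] × ℝ^d` are exactly the restrictions of `C¹` functions on `ℝ × ℝ^d`. -/
def WeakEquation (T : ℝ) (A : Space d →L[ℝ] Space d) (α₀ : Measure (Space d))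
    (α : ℝ → ProbabilityMeasure (Space d)) (γ : Kernel ℝ (Space d × Space d)) : Prop :=
  ∀ f : ℝ × Space d → ℝ, ContDiff ℝ 1 f →
    (∫ t in (0 : ℝ)..T, ∫ x,
        (deriv (fun s => f (s, x)) t + inner ℝ (A x) (gradient (fun z => f (t, z)) x))
          ∂(α t : Measure (Space d)))
      - (∫ t in (0 : ℝ)..T, ∫ p, inner ℝ (A p.2) (gradient (fun z => f (t, z)) p.1) ∂(γ t))
    = (∫ x, f (T, x) ∂(α T : Measure (Space d))) - ∫ x, f (0, x) ∂α₀

/-- The conditions common to weak solutions of the semi-geostrophic system and of its entropic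
regularization: `α` is a `W2`-continuous curve starting from `α₀`, supported in the ball of
radius `2 R₀ exp(‖A‖ T)`, and satisfies the weak formulation with the measurable family `γ`. -/
structure IsWeakCurve (T R₀ : ℝ) (A : Space d →L[ℝ] Space d) (α₀ : Measure (Space d))
    (α : ℝ → ProbabilityMeasure (Space d)) (γ : Kernel ℝ (Space d × Space d)) : Prop where
  continuous : W2Continuous T α
  initial : (α 0 : Measure (Space d)) = α₀
  support : ∀ t ∈ Icc 0 T,
    SupportedInBall (α t : Measure (Space d)) (2 * R₀ * Real.exp (‖A‖ * T))
  equation : WeakEquation T A α₀ α γ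

/-- `α` is a weak solution of the semi-geostrophic system with the family of plans `γ`:
for a.e. `t`, `γ_t` is an optimal plan between `α_t` and `μ₀`. -/
def IsSGSolutionWith (T R₀ : ℝ) (A : Space d →L[ℝ] Space d) (α₀ μ₀ : Measure (Space d))
    (α : ℝ → ProbabilityMeasure (Space d)) (γ : Kernel ℝ (Space d × Space d)) : Prop :=
  IsWeakCurve T R₀ A α₀ α γ ∧
    ∀ᵐ t ∂(volume.restrict (Icc 0 T)), IsOptimalPlan (α t : Measure (Space d)) μ₀ (γ t)

/-- `α` is a weak solution of the semi-geostrophic system. -/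
def IsSGSolution (T R₀ : ℝ) (A : Space d →L[ℝ] Space d) (α₀ μ₀ : Measure (Space d))
    (α : ℝ → ProbabilityMeasure (Space d)) : Prop :=
  ∃ γ : Kernel ℝ (Space d × Space d), IsSGSolutionWith T R₀ A α₀ μ₀ α γ

/-- `α` is a weak solution of the entropic semi-geostrophic system with parameter `ε` and with
the family of plans `γ`: for a.e. `t`, `γ_t` solves the entropic optimal transport problem
between `α_t` and `μ₀`. -/
def IsEntropicSolutionWith (ε T R₀ : ℝ) (A : Space d →L[ℝ] Space d) (α₀ μ₀ : Measure (Space d))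
    (α : ℝ → ProbabilityMeasure (Space d)) (γ : Kernel ℝ (Space d × Space d)) : Prop :=
  IsWeakCurve T R₀ A α₀ α γ ∧
    ∀ᵐ t ∂(volume.restrict (Icc 0 T)), IsEntropicPlan ε (α t : Measure (Space d)) μ₀ (γ t)

/-- `α` is a weak solution of the entropic semi-geostrophic system with parameter `ε`. -/
def IsEntropicSolution (ε T R₀ : ℝ) (A : Space d →L[ℝ] Space d) (α₀ μ₀ : Measure (Space d))
    (α : ℝ → ProbabilityMeasure (Space d)) : Prop :=
  ∃ γ : Kernel ℝ (Space d × Space d), IsEntropicSolutionWith ε T R₀ A α₀ μ₀ α γ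

/-- Weak-* convergence on `[0, T] × ℝ^d × ℝ^d` of `dt ⊗ γ^n_t` to `dt ⊗ γ_t`, tested against
bounded continuous functions. -/
def PlansConverge (T : ℝ) (γs : ℕ → Kernel ℝ (Space d × Space d))
    (γ : Kernel ℝ (Space d × Space d)) : Prop :=
  ∀ g : BoundedContinuousFunction (ℝ × Space d × Space d) ℝ,
    Tendsto (fun n => ∫ t in (0 : ℝ)..T, ∫ p, g (t, p) ∂(γs n t)) atTop
      (𝓝 (∫ t in (0 : ℝ)..T, ∫ p, g (t, p) ∂(γ t)))

end

end SemiGeo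

namespace SemiGeo

variable {d : ℕ}

/-! ### Elementary properties of transport plans and of the Wasserstein distance -/

/-! Stability and existence both rest on one limit theorem, `isSGSolutionWith_of_tendsto`. Once
`γ_t` has marginals `α_t` and `μ₀`, the weak equation is linear in the measure `dt ⊗ γ_t` and tests
it against a single continuous function (`weakEquation_iff`). These measures live on one compact
set, so they have weak limits, and the equation passes to the limit. A limit disintegrates over time
into plans between `α_t` and `μ₀`, because the marginals converge (`condKernel_fst`,
`condKernel_snd`). Optimality is recovered after integration in time: if the approximating plans are
nearly optimal, the limit satisfies `∫ quadCost γ_t dt ≤ ∫ W2sq α_t μ₀ dt`. The opposite inequality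
holds for a.e. `t`, so equality holds for a.e. `t`.

For entropic solutions, near optimality must be uniform in time. Any nearly optimal plan can be
smeared in the `y` variable inside small cells. This keeps the marginals, changes the `L²` cost by
at most `δ`, and bounds the entropy by a constant depending only on `μ₀` and `δ`
(`exists_plan_klDiv_le`). Used as a competitor, it shows that entropic plans are nearly optimal once
`ε` is small compared with `δ`.

Existence does not go through entropic solutions. A nearly optimal plan is frozen during a short
time step while each pair moves by `x' = A (x - y)`, `y' = 0`, solved explicitly with `exp (s A)`.
The interpolated curves solve the weak equation exactly, are equi-Lipschitz in `W2`, and carry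
nearly optimal plans. Limits along an ultrafilter then fall under the same limit theorem. -/

lemma quadCost_rpow_half (γ : Measure (Space d × Space d)) :
    quadCost γ ^ (1 / 2 : ℝ) = eLpNorm (fun p : Space d × Space d => p.1 - p.2) 2 γ := by
  rw [eLpNorm_eq_lintegral_rpow_enorm_toReal (by norm_num) (by norm_num)]
  simp [quadCost]

lemma quadCost_eq_eLpNorm_sq (γ : Measure (Space d × Space d)) :
    quadCost γ = eLpNorm (fun p : Space d × Space d => p.1 - p.2) 2 γ ^ 2 := by
  rw [← quadCost_rpow_half, ← ENNReal.rpow_natCast, ← ENNReal.rpow_mul]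
  norm_num

lemma W2sq_eq_sq (a b : Measure (Space d)) : W2sq a b = W2 a b ^ 2 := by
  rw [W2, ← ENNReal.rpow_natCast, ← ENNReal.rpow_mul]
  norm_num

lemma W2sq_le {a b : Measure (Space d)} {γ : Measure (Space d × Space d)} (h : γ ∈ plans a b) :
    W2sq a b ≤ quadCost γ :=
  iInf₂_le γ h

lemma exists_plan_quadCost_lt {a b : Measure (Space d)} {c : ℝ≥0∞} (h : W2sq a b < c) :
    ∃ γ ∈ plans a b, quadCost γ < c := by
  simpa only [W2sq, iInf_lt_iff, exists_prop] using h

lemma W2_le {a b : Measure (Space d)} {γ : Measure (Space d × Space d)} (h : γ ∈ plans a b) :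
    W2 a b ≤ eLpNorm (fun p : Space d × Space d => p.1 - p.2) 2 γ := by
  rw [← quadCost_rpow_half]
  exact ENNReal.rpow_le_rpow (W2sq_le h) (by norm_num)

/-- Nearly optimal plans serve wherever a plan must be chosen, so attainment of the infimum is never
needed beforehand. -/
lemma exists_plan_eLpNorm_lt {a b : Measure (Space d)} {c : ℝ≥0∞} (h : W2 a b < c) :
    ∃ γ ∈ plans a b, eLpNorm (fun p : Space d × Space d => p.1 - p.2) 2 γ < c := by
  have h2 : W2sq a b < c ^ 2 := by
    rw [W2sq_eq_sq]
    exact ENNReal.pow_lt_pow_left two_ne_zero h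
  obtain ⟨γ, hγ, hlt⟩ := exists_plan_quadCost_lt h2
  refine ⟨γ, hγ, ?_⟩
  rw [quadCost_eq_eLpNorm_sq] at hlt
  exact (ENNReal.pow_lt_pow_left_iff two_ne_zero).1 hlt

lemma isProbabilityMeasure_of_mem_plans {a b : Measure (Space d)} [IsProbabilityMeasure a]
    {γ : Measure (Space d × Space d)} (h : γ ∈ plans a b) : IsProbabilityMeasure γ := by
  refine ⟨?_⟩
  have := measure_univ (μ := a)
  rwa [← h.1, Measure.fst_univ] at this

lemma prod_mem_plans (a b : Measure (Space d)) [IsProbabilityMeasure a] [IsProbabilityMeasure b] :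
    a.prod b ∈ plans a b :=
  ⟨Measure.fst_prod, Measure.snd_prod⟩

lemma map_prodMk_mem_plans {Ω : Type*} [MeasurableSpace Ω] (m : Measure Ω) {X Y : Ω → Space d}
    (hX : Measurable X) (hY : Measurable Y) :
    m.map (fun ω => (X ω, Y ω)) ∈ plans (m.map X) (m.map Y) :=
  ⟨Measure.fst_map_prodMk hY, Measure.snd_map_prodMk hX⟩

lemma W2_map_le {Ω : Type*} [MeasurableSpace Ω] (m : Measure Ω) {X Y : Ω → Space d}
    (hX : Measurable X) (hY : Measurable Y) :
    W2 (m.map X) (m.map Y) ≤ eLpNorm (fun ω => X ω - Y ω) 2 m := by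
  refine (W2_le (map_prodMk_mem_plans m hX hY)).trans_eq ?_
  rw [eLpNorm_map_measure (by fun_prop) (by fun_prop)]
  rfl

lemma W2_self (a : Measure (Space d)) : W2 a a = 0 := by
  have := W2_map_le a (X := id) (Y := id) measurable_id measurable_id
  simpa using this

lemma W2_comm_le (a b : Measure (Space d)) : W2 a b ≤ W2 b a := by
  refine le_of_forall_gt fun c hc => ?_
  obtain ⟨γ, ⟨rfl, rfl⟩, hlt⟩ := exists_plan_eLpNorm_lt hc
  refine (W2_map_le γ measurable_snd measurable_fst).trans_lt (lt_of_eq_of_lt ?_ hlt)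
  rw [← eLpNorm_neg]
  congr 1
  ext p
  simp

lemma W2_comm (a b : Measure (Space d)) : W2 a b = W2 b a :=
  le_antisymm (W2_comm_le a b) (W2_comm_le b a)

/-- Gluing of two transport plans along their common marginal. -/
lemma exists_gluing {a b c : Measure (Space d)} {γ₁ γ₂ : Measure (Space d × Space d)}
    [IsFiniteMeasure γ₁] [IsFiniteMeasure γ₂] (h₁ : γ₁ ∈ plans a b) (h₂ : γ₂ ∈ plans b c) :
    ∃ π : Measure ((Space d × Space d) × Space d),
      π.map Prod.fst = γ₁ ∧ π.map (fun q => (q.1.2, q.2)) = γ₂ := by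
  -- Draw `(x, y)` from `γ₁`, then `z` from `γ₂` conditioned on its first coordinate being `y`.
  refine ⟨γ₁ ⊗ₘ (γ₂.condKernel.comap Prod.snd measurable_snd), Measure.fst_compProd _ _, ?_⟩
  conv_rhs => rw [← γ₂.disintegrate γ₂.condKernel, h₂.1, ← h₁.2]
  ext s hs
  have hm : Measurable fun q : (Space d × Space d) × Space d => (q.1.2, q.2) := by fun_prop
  rw [Measure.map_apply hm hs, Measure.compProd_apply (hm hs),
    Measure.compProd_apply hs, Measure.snd,
    lintegral_map (Kernel.measurable_kernel_prodMk_left hs) measurable_snd]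
  rfl

/-- Minkowski's inequality in `L²` of the gluing of two nearly optimal plans. -/
lemma W2_triangle (a b c : Measure (Space d)) [IsProbabilityMeasure a] [IsProbabilityMeasure b] :
    W2 a c ≤ W2 a b + W2 b c := by
  have key : ∀ c₁ c₂ : ℝ≥0∞, W2 a b < c₁ → W2 b c < c₂ → W2 a c ≤ c₁ + c₂ := by
    intro c₁ c₂ hc₁ hc₂
    obtain ⟨γ₁, h₁, hlt₁⟩ := exists_plan_eLpNorm_lt hc₁
    obtain ⟨γ₂, h₂, hlt₂⟩ := exists_plan_eLpNorm_lt hc₂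
    have := isProbabilityMeasure_of_mem_plans h₁
    have := isProbabilityMeasure_of_mem_plans h₂
    obtain ⟨π, h12, h23⟩ := exists_gluing h₁ h₂
    have hx : π.map (fun q => q.1.1) = a := by
      rw [← h₁.1, Measure.fst, ← h12, Measure.map_map (by fun_prop) (by fun_prop)]
      rfl
    have hz : π.map (fun q => q.2) = c := by
      rw [← h₂.2, Measure.snd, ← h23, Measure.map_map (by fun_prop) (by fun_prop)]
      rfl
    have e1 : eLpNorm (fun q : (Space d × Space d) × Space d => q.1.1 - q.1.2) 2 π
        = eLpNorm (fun p : Space d × Space d => p.1 - p.2) 2 γ₁ := by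
      rw [← h12, eLpNorm_map_measure (by fun_prop) (by fun_prop)]
      rfl
    have e2 : eLpNorm (fun q : (Space d × Space d) × Space d => q.1.2 - q.2) 2 π
        = eLpNorm (fun p : Space d × Space d => p.1 - p.2) 2 γ₂ := by
      rw [← h23, eLpNorm_map_measure (by fun_prop) (by fun_prop)]
      rfl
    have e3 : eLpNorm (fun q : (Space d × Space d) × Space d => q.1.1 - q.2) 2 π
        ≤ eLpNorm (fun q : (Space d × Space d) × Space d => q.1.1 - q.1.2) 2 π
          + eLpNorm (fun q : (Space d × Space d) × Space d => q.1.2 - q.2) 2 π := by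
      refine le_of_eq_of_le ?_ (eLpNorm_add_le (by fun_prop) (by fun_prop) (by norm_num))
      congr 1
      ext q : 1
      simp
    rw [e1, e2] at e3
    rw [← hx, ← hz]
    exact (W2_map_le π (by fun_prop) (by fun_prop)).trans (e3.trans (add_le_add hlt₁.le hlt₂.le))
  rcases eq_or_ne (W2 a b + W2 b c) ∞ with htop | htop
  · simp [htop]
  rw [ENNReal.add_ne_top] at htop
  refine ENNReal.le_of_forall_pos_le_add fun η hη _ => ?_
  have hη2 : (η / 2 : ℝ≥0∞) ≠ 0 := by simpa using hη.ne'
  refine (key _ _ (ENNReal.lt_add_right htop.1 hη2) (ENNReal.lt_add_right htop.2 hη2)).trans_eq ?_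
  rw [add_add_add_comm, ENNReal.add_halves]

/-- Integrate `|f x - f y| ≤ L |x - y|` against a nearly optimal plan, then bound the `L¹` norm by
the `L²` norm, the plan having mass one. -/
lemma enorm_integral_sub_le_W2 {a b : Measure (Space d)} [IsProbabilityMeasure a]
    [IsProbabilityMeasure b] {f : Space d → ℝ} {L : NNReal} (hf : LipschitzWith L f)
    (hb : ∃ C, ∀ x, ‖f x‖ ≤ C) :
    ‖∫ x, f x ∂a - ∫ x, f x ∂b‖ₑ ≤ L * W2 a b := by
  obtain ⟨C, hC⟩ := hb
  rcases eq_or_ne (W2 a b) ∞ with htop | htop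
  -- Since `0 * ∞ = 0` in `ℝ≥0∞`, the case `L = 0` is not trivial here and uses that `f` is
  -- constant.
  · rcases eq_or_ne L 0 with rfl | hL
    · have hconst : ∀ x, f x = f 0 := fun x => by
        have := hf x 0
        simpa using this
      rw [show f = fun _ => f 0 from funext hconst]
      simp
    · rw [htop, ENNReal.mul_top (by simpa using hL)]
      exact le_top
  refine ENNReal.le_of_forall_pos_le_add fun η hη _ => ?_
  have key : ∀ c, W2 a b < c → ‖∫ x, f x ∂a - ∫ x, f x ∂b‖ₑ ≤ L * c := by
    intro c hc
    obtain ⟨γ, hγ, hlt⟩ := exists_plan_eLpNorm_lt hc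
    have := isProbabilityMeasure_of_mem_plans hγ
    have hfm : Measurable f := hf.continuous.measurable
    have i1 : Integrable (fun p : Space d × Space d => f p.1) γ :=
      Integrable.of_bound (hfm.comp measurable_fst).aestronglyMeasurable C (.of_forall fun p => hC _)
    have i2 : Integrable (fun p : Space d × Space d => f p.2) γ :=
      Integrable.of_bound (hfm.comp measurable_snd).aestronglyMeasurable C (.of_forall fun p => hC _)
    have ha : ∫ x, f x ∂a = ∫ p, f p.1 ∂γ := by
      rw [← hγ.1, Measure.fst, integral_map (by fun_prop) (by fun_prop)]
    have hb : ∫ x, f x ∂b = ∫ p, f p.2 ∂γ := by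
      rw [← hγ.2, Measure.snd, integral_map (by fun_prop) (by fun_prop)]
    rw [ha, hb, ← integral_sub i1 i2]
    calc ‖∫ p, (f p.1 - f p.2) ∂γ‖ₑ ≤ ∫⁻ p, ‖f p.1 - f p.2‖ₑ ∂γ :=
          enorm_integral_le_lintegral_enorm _
      _ ≤ ∫⁻ p, L * ‖p.1 - p.2‖ₑ ∂γ := by
          refine lintegral_mono fun p => ?_
          have := hf p.1 p.2
          rwa [edist_eq_enorm_sub, edist_eq_enorm_sub] at this
      _ = L * eLpNorm (fun p : Space d × Space d => p.1 - p.2) 1 γ := by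
          rw [lintegral_const_mul _ (by fun_prop), eLpNorm_one_eq_lintegral_enorm]
      _ ≤ L * eLpNorm (fun p : Space d × Space d => p.1 - p.2) 2 γ := by
          gcongr
          exact eLpNorm_le_eLpNorm_of_exponent_le (by norm_num) (by fun_prop)
      _ ≤ L * c := by gcongr
  -- Dividing by `L + 1` instead of `L` avoids a separate case `L = 0`.
  have hL1 : (η / (L + 1) : ℝ≥0∞) ≠ 0 := by
    simp only [ne_eq, ENNReal.div_eq_zero_iff, ENNReal.coe_eq_zero, hη.ne', false_or]
    exact ENNReal.add_ne_top.2 ⟨ENNReal.coe_ne_top, ENNReal.one_ne_top⟩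
  refine (key _ (ENNReal.lt_add_right htop hL1)).trans ?_
  rw [mul_add]
  gcongr
  rw [mul_comm, ENNReal.div_eq_inv_mul, mul_right_comm]
  calc ((L : ℝ≥0∞) + 1)⁻¹ * L * η ≤ ((L : ℝ≥0∞) + 1)⁻¹ * (L + 1) * η := by
        gcongr; exact le_self_add
    _ = η := by
        rw [ENNReal.inv_mul_cancel (by simp)
          (ENNReal.add_ne_top.2 ⟨ENNReal.coe_ne_top, ENNReal.one_ne_top⟩), one_mul]

/-! ### Measures carried by balls: support and cost bounds. -/

lemma ae_norm_le_of_supportedInBall {a : Measure (Space d)} {R : ℝ} (h : SupportedInBall a R) :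
    ∀ᵐ x ∂a, ‖x‖ ≤ R := by
  have : ∀ᵐ x ∂a, x ∈ Metric.closedBall (0 : Space d) R := h
  filter_upwards [this] with x hx
  simpa using hx

lemma supportedInBall_of_ae {a : Measure (Space d)} {R : ℝ} (h : ∀ᵐ x ∂a, ‖x‖ ≤ R) :
    SupportedInBall a R := by
  have : ∀ᵐ x ∂a, x ∈ Metric.closedBall (0 : Space d) R := by
    filter_upwards [h] with x hx
    simpa using hx
  exact this

lemma ae_fst_of_mem_plans {a b : Measure (Space d)} {γ : Measure (Space d × Space d)}
    (h : γ ∈ plans a b) {p : Space d → Prop} (hp : ∀ᵐ x ∂a, p x) : ∀ᵐ q ∂γ, p q.1 := by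
  rw [← h.1] at hp
  exact ae_of_ae_map measurable_fst.aemeasurable hp

lemma ae_snd_of_mem_plans {a b : Measure (Space d)} {γ : Measure (Space d × Space d)}
    (h : γ ∈ plans a b) {p : Space d → Prop} (hp : ∀ᵐ x ∂b, p x) : ∀ᵐ q ∂γ, p q.2 := by
  rw [← h.2] at hp
  exact ae_of_ae_map measurable_snd.aemeasurable hp

lemma quadCost_le_of_supportedInBall {a b : Measure (Space d)} [IsProbabilityMeasure a]
    {R r : ℝ} (ha : SupportedInBall a R)
    (hb : SupportedInBall b r) {γ : Measure (Space d × Space d)} (h : γ ∈ plans a b) :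
    quadCost γ ≤ ENNReal.ofReal (R + r) ^ 2 := by
  have := isProbabilityMeasure_of_mem_plans h
  calc quadCost γ ≤ ∫⁻ _, ENNReal.ofReal (R + r) ^ 2 ∂γ := by
        refine lintegral_mono_ae ?_
        filter_upwards [ae_fst_of_mem_plans h (ae_norm_le_of_supportedInBall ha),
          ae_snd_of_mem_plans h (ae_norm_le_of_supportedInBall hb)] with p h1 h2
        gcongr
        rw [← ofReal_norm]
        exact ENNReal.ofReal_le_ofReal ((norm_sub_le _ _).trans (add_le_add h1 h2))
    _ = _ := by simp

lemma W2_le_of_supportedInBall {a b : Measure (Space d)} [IsProbabilityMeasure a]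
    [IsProbabilityMeasure b] {R r : ℝ} (ha : SupportedInBall a R)
    (hb : SupportedInBall b r) : W2 a b ≤ ENNReal.ofReal (R + r) := by
  have := (W2sq_le (prod_mem_plans a b)).trans
    (quadCost_le_of_supportedInBall ha hb (prod_mem_plans a b))
  rw [W2sq_eq_sq] at this
  exact (ENNReal.pow_le_pow_left_iff two_ne_zero).1 this

/-! ### Weak convergence in a ball implies convergence in the Wasserstein distance -/

lemma quadCost_add (γ₁ γ₂ : Measure (Space d × Space d)) :
    quadCost (γ₁ + γ₂) = quadCost γ₁ + quadCost γ₂ :=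
  lintegral_add_measure _ _ _

lemma quadCost_finset_sum {ι : Type*} (s : Finset ι) (γ : ι → Measure (Space d × Space d)) :
    quadCost (∑ i ∈ s, γ i) = ∑ i ∈ s, quadCost (γ i) :=
  lintegral_finsetSum_measure _ _ _

lemma quadCost_smul (c : ℝ≥0∞) (γ : Measure (Space d × Space d)) :
    quadCost (c • γ) = c * quadCost γ :=
  lintegral_smul_measure _ _

lemma quadCost_prod_le {a b : Measure (Space d)} [SFinite b] [SFinite a] {C : ℝ≥0∞}
    {p q : Space d → Prop} (ha : ∀ᵐ x ∂a, p x) (hb : ∀ᵐ y ∂b, q y)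
    (h : ∀ x y, p x → q y → ‖x - y‖ₑ ≤ C) : quadCost (a.prod b) ≤ C ^ 2 * (a univ * b univ) := by
  calc quadCost (a.prod b) = ∫⁻ x, ∫⁻ y, ‖x - y‖ₑ ^ 2 ∂b ∂a :=
        lintegral_prod _ (by fun_prop)
    _ ≤ ∫⁻ _, ∫⁻ _, C ^ 2 ∂b ∂a := by
        refine lintegral_mono_ae ?_
        filter_upwards [ha] with x hx
        refine lintegral_mono_ae ?_
        filter_upwards [hb] with y hy
        gcongr
        exact h x y hx hy
    _ = _ := by
        rw [lintegral_const, lintegral_const]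
        ring

lemma fst_finset_sum {ι : Type*} (s : Finset ι) (γ : ι → Measure (Space d × Space d)) :
    (∑ i ∈ s, γ i).fst = ∑ i ∈ s, (γ i).fst := by
  ext t ht
  simp [Measure.fst_apply ht, Measure.finsetSum_apply]

lemma snd_finset_sum {ι : Type*} (s : Finset ι) (γ : ι → Measure (Space d × Space d)) :
    (∑ i ∈ s, γ i).snd = ∑ i ∈ s, (γ i).snd := by
  ext t ht
  simp [Measure.snd_apply ht, Measure.finsetSum_apply]

lemma fst_prod_eq_smul (a b : Measure (Space d)) [SFinite b] :
    (a.prod b).fst = b univ • a := by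
  ext t ht
  rw [Measure.fst_apply ht, ← prod_univ, Measure.prod_prod]
  simp [mul_comm]

lemma snd_prod_eq_smul (a b : Measure (Space d)) [SFinite b] [SFinite a] :
    (a.prod b).snd = a univ • b := by
  ext t ht
  rw [Measure.snd_apply ht, ← univ_prod, Measure.prod_prod]
  simp

/-- If two probability measures split into pieces carried by common sets of small diameter, and the
masses of the pieces are comparable, then the measures are close in Wasserstein distance. -/
lemma W2sq_le_of_pieces {ι : Type*} [Fintype ι] {a b : Measure (Space d)}
    [IsProbabilityMeasure a] [IsProbabilityMeasure b] (as bs : ι → Measure (Space d))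
    [∀ j, IsFiniteMeasure (as j)] [∀ j, IsFiniteMeasure (bs j)]
    (has : ∑ j, as j = a) (hbs : ∑ j, bs j = b) {R : ℝ} (ha : SupportedInBall a R)
    (hb : SupportedInBall b R) (s : ι → Set (Space d)) {δ θ : ℝ≥0∞} (hθ0 : θ ≠ 0) (hθ1 : θ ≤ 1)
    (hsa : ∀ j, ∀ᵐ x ∂as j, x ∈ s j) (hsb : ∀ j, ∀ᵐ x ∂bs j, x ∈ s j)
    (hs : ∀ j, ∀ x ∈ s j, ∀ y ∈ s j, ‖x - y‖ₑ ≤ δ)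
    (hθ : ∀ j, θ * bs j univ ≤ as j univ) :
    W2sq a b ≤ δ ^ 2 + ENNReal.ofReal (R + R) ^ 2 * (1 - θ) := by
  have hθt : θ ≠ ∞ := ne_top_of_le_ne_top ENNReal.one_ne_top hθ1
  -- Division by the mass of `as j` is then harmless: when that mass vanishes, `bs j` vanishes too.
  have hbz : ∀ j, as j univ = 0 → bs j = 0 := fun j hj => by
    have := hθ j
    rw [hj, nonpos_iff_eq_zero, mul_eq_zero, or_iff_right hθ0] at this
    exact Measure.measure_univ_eq_zero.1 this
  -- The fraction of `as j` that is coupled, inside the `j`-th set, with the part `θ • bs j` of the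
  -- target piece.
  set c : ι → ℝ≥0∞ := fun j => θ / as j univ * bs j univ with hc
  have hc1 : ∀ j, c j ≤ 1 := fun j => by
    rw [hc]
    simp only
    rw [ENNReal.div_eq_inv_mul, mul_assoc, ← ENNReal.div_eq_inv_mul]
    exact ENNReal.div_le_of_le_mul (by simpa using hθ j)
  have hca : ∀ j, θ / as j univ * as j univ * bs j univ = θ * bs j univ := fun j => by
    rcases eq_or_ne (as j univ) 0 with h0 | h0
    · simp [hbz j h0]
    · rw [ENNReal.div_mul_cancel h0 (measure_ne_top _ _)]
  set r : Measure (Space d) := ∑ j, (1 - c j) • as j with hr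
  have hrsum : r + ∑ j, c j • as j = a := by
    rw [hr, ← Finset.sum_add_distrib, ← has]
    refine Finset.sum_congr rfl fun j _ => ?_
    rw [← add_smul, tsub_add_cancel_of_le (hc1 j), one_smul]
  have hbu : ∑ j, bs j univ = 1 := by
    rw [← measure_univ (μ := b), ← hbs, Measure.finsetSum_apply]
  have hru : r univ + θ = 1 := by
    have : (∑ j, c j • as j) univ = θ := by
      rw [Measure.finsetSum_apply, ← mul_one θ, ← hbu, Finset.mul_sum]
      refine Finset.sum_congr rfl fun j _ => ?_
      rw [Measure.smul_apply, smul_eq_mul, ← hca j, hc]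
      ring
    rw [← measure_univ (μ := a), ← hrsum, Measure.add_apply, this]
  have hr1 : r univ = 1 - θ := ENNReal.eq_sub_of_add_eq hθt hru
  have hra : r ≤ a := by
    rw [← hrsum]
    exact Measure.le_add_right le_rfl
  have : IsFiniteMeasure r := isFiniteMeasure_of_le a hra
  -- Normalized products inside each set carry mass `θ` at distance at most `δ`. The leftover `r`,
  -- of mass `1 - θ`, is coupled arbitrarily with `b`, at distance at most `R + R`.
  set π : Measure (Space d × Space d) :=
    ∑ j, (θ / as j univ) • (as j).prod (bs j) + r.prod b with hπ
  have hplan : π ∈ plans a b := by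
    constructor
    · rw [hπ, Measure.fst_add, fst_finset_sum, fst_prod_eq_smul, measure_univ, one_smul, add_comm]
      rw [← hrsum]
      congr 1
      refine Finset.sum_congr rfl fun j _ => ?_
      ext t ht
      rw [Measure.fst_apply ht, ← prod_univ, Measure.smul_apply, Measure.prod_prod, hc]
      simp only [smul_eq_mul, Measure.smul_apply]
      ring
    · rw [hπ, Measure.snd_add, snd_finset_sum, snd_prod_eq_smul, hr1]
      have : ∑ j, ((θ / as j univ) • (as j).prod (bs j)).snd = θ • b := by
        rw [← hbs, Finset.smul_sum]
        refine Finset.sum_congr rfl fun j _ => ?_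
        ext t ht
        rw [Measure.snd_apply ht, ← univ_prod, Measure.smul_apply, Measure.prod_prod,
          Measure.smul_apply]
        rcases eq_or_ne (as j univ) 0 with h0 | h0
        · simp [hbz j h0]
        · rw [smul_eq_mul, ← mul_assoc, ENNReal.div_mul_cancel h0 (measure_ne_top _ _), smul_eq_mul]
      rw [this, ← add_smul, add_tsub_cancel_of_le hθ1, one_smul]
  refine (W2sq_le hplan).trans ?_
  rw [hπ, quadCost_add, quadCost_finset_sum]
  gcongr
  · calc ∑ j, quadCost ((θ / as j univ) • (as j).prod (bs j))
        ≤ ∑ j, δ ^ 2 * (θ * bs j univ) := by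
          refine Finset.sum_le_sum fun j _ => ?_
          rw [quadCost_smul, ← hca j]
          refine (mul_le_mul_right (quadCost_prod_le (hsa j) (hsb j)
            (fun x y hx hy => hs j x hx y hy)) _).trans_eq ?_
          ring
      _ = δ ^ 2 * θ := by rw [← Finset.mul_sum, ← Finset.mul_sum, hbu, mul_one]
      _ ≤ δ ^ 2 := mul_le_of_le_one_right' hθ1
  · refine (quadCost_prod_le (p := fun x => ‖x‖ ≤ R) (q := fun x => ‖x‖ ≤ R)
      (C := ENNReal.ofReal (R + R)) ?_ (ae_norm_le_of_supportedInBall hb) ?_).trans_eq ?_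
    · exact Measure.absolutelyContinuous_of_le hra (ae_norm_le_of_supportedInBall ha)
    · intro x y hx hy
      rw [← ofReal_norm]
      exact ENNReal.ofReal_le_ofReal ((norm_sub_le _ _).trans (add_le_add hx hy))
    · rw [hr1, measure_univ, mul_one]

/-- Continuous weights are used instead of Borel cells: the masses `∫ ρ_j` then converge under weak
convergence, with no condition on the boundaries of cells. -/
lemma exists_continuous_partition (K : Set (Space d)) (hK : IsCompact K) {e : ℝ} (he : 0 < e) :
    ∃ (t : Finset (Space d)) (ρ : t → C(Space d, ℝ)), (∀ j x, 0 ≤ ρ j x) ∧ (∀ j x, ρ j x ≤ 1) ∧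
      (∀ x ∈ K, ∑ j, ρ j x = 1) ∧ ∀ j x, ρ j x ≠ 0 → dist x j < e := by
  obtain ⟨t, -, htf, hcov⟩ := hK.finite_cover_balls he
  obtain ⟨t, rfl⟩ := htf.exists_finset_coe
  obtain ⟨ρ, hρ⟩ := PartitionOfUnity.exists_isSubordinate_of_locallyFinite
    (s := K) hK.isClosed
    (fun j : t => Metric.ball (j : Space d) e) (fun _ => Metric.isOpen_ball)
    (locallyFinite_of_finite _) (by rwa [iUnion_subtype])
  refine ⟨t, fun j => ρ j, ρ.nonneg, fun j x => ρ.le_one j x, fun x hx => ?_, fun j x h => ?_⟩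
  · rw [← finsum_eq_sum_of_fintype]
    exact ρ.sum_eq_one hx
  · exact hρ j (subset_tsupport _ h)

/-- Weak convergence of probability measures carried by a fixed ball implies convergence in the
Wasserstein distance. -/
lemma tendsto_W2_of_tendsto {ι : Type*} {l : Filter ι} {as : ι → ProbabilityMeasure (Space d)}
    {a : ProbabilityMeasure (Space d)} {R : ℝ}
    (has : ∀ i, SupportedInBall (as i : Measure (Space d)) R)
    (ha : SupportedInBall (a : Measure (Space d)) R) (h : Tendsto as l (𝓝 a)) :
    Tendsto (fun i => W2 (as i : Measure (Space d)) a) l (𝓝 0) := by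
  have key : ∀ e : ℝ, 0 < e → ∀ᶠ i in l, W2 (as i : Measure (Space d)) a ≤ ENNReal.ofReal e := by
    intro e he
    obtain ⟨t, ρ, hρ0, hρ1, hρs, hρd⟩ := exists_continuous_partition
      (Metric.closedBall (0 : Space d) R) (isCompact_closedBall _ _)
      (show 0 < e / 4 by positivity)
    set pc : ProbabilityMeasure (Space d) → t → Measure (Space d) :=
      fun m j => (m : Measure (Space d)).withDensity fun x => ENNReal.ofReal (ρ j x) with hpc
    have hfin : ∀ m j, IsFiniteMeasure (pc m j) := fun m j => by
      refine isFiniteMeasure_withDensity_ofReal ?_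
      refine (Integrable.of_bound (ρ j).continuous.aestronglyMeasurable 1
        (.of_forall fun x => ?_)).2
      rw [Real.norm_eq_abs, abs_of_nonneg (hρ0 j x)]
      exact hρ1 j x
    have hsum : ∀ m : ProbabilityMeasure (Space d), SupportedInBall (m : Measure (Space d)) R →
        ∑ j, pc m j = m := fun m hm => by
      ext s hs
      rw [Measure.finsetSum_apply]
      simp only [hpc, withDensity_apply _ hs]
      rw [← lintegral_finsetSum _ (fun j _ => by fun_prop)]
      have : ∀ᵐ x ∂((m : Measure (Space d)).restrict s), ∑ j, ENNReal.ofReal (ρ j x) = 1 := by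
        refine ae_restrict_of_ae ?_
        filter_upwards [ae_norm_le_of_supportedInBall hm] with x hx
        rw [← ENNReal.ofReal_sum_of_nonneg (fun j _ => hρ0 j x),
          hρs x (by simpa using hx), ENNReal.ofReal_one]
      rw [lintegral_congr_ae this]
      simp
    have hcar : ∀ (m : ProbabilityMeasure (Space d)) (j : t), ∀ᵐ x ∂pc m j, x ∈ Metric.ball (j : Space d) (e / 4) := fun m j => by
      refine (ae_withDensity_iff (by fun_prop)).2 (.of_forall fun x hx => hρd j x ?_)
      intro h0
      simp [h0] at hx
    have hlim : ∀ j, Tendsto (fun i => pc (as i) j univ) l (𝓝 (pc a j univ)) := fun j => by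
      have h2 := (ProbabilityMeasure.tendsto_iff_forall_lintegral_tendsto.1 h)
        (BoundedContinuousFunction.mkOfBound ⟨fun x => Real.toNNReal (ρ j x), by fun_prop⟩ 1 ?_)
      · simpa [hpc] using! h2
      · intro x y
        rw [NNReal.dist_eq, abs_le]
        simp only [ContinuousMap.coe_mk, Real.coe_toNNReal _ (hρ0 j _)]
        constructor <;> linarith [hρ0 j x, hρ0 j y, hρ1 j x, hρ1 j y]
    -- Chosen so that the leftover mass costs at most `e ^ 2 / 4`; the local part costs `(e / 2) ^
    -- 2`. The `+ 1` keeps the denominator positive, and `1 / 2` keeps `θ = 1 - η` positive.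
    set η : ℝ := min (1 / 2) (e ^ 2 / (4 * ((R + R) ^ 2 + 1))) with hη
    have hη0 : 0 < η := by positivity
    have hη1 : η ≤ 1 / 2 := min_le_left _ _
    have hη2 : (R + R) ^ 2 * η ≤ e ^ 2 / 4 := by
      have : η ≤ e ^ 2 / (4 * ((R + R) ^ 2 + 1)) := min_le_right _ _
      rw [le_div_iff₀ (by positivity)] at this
      nlinarith [sq_nonneg (R + R)]
    set θ := ENNReal.ofReal (1 - η) with hθ
    have hθ1 : θ < 1 := by
      rw [hθ, ← ENNReal.ofReal_one]
      exact (ENNReal.ofReal_lt_ofReal_iff one_pos).2 (by linarith)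
    have hθ0 : θ ≠ 0 := by
      rw [hθ, ne_eq, ENNReal.ofReal_eq_zero]
      linarith
    have hev : ∀ᶠ i in l, ∀ j, θ * pc a j univ ≤ pc (as i) j univ := by
      rw [eventually_all]
      intro j
      -- A piece with zero limit mass imposes nothing; otherwise its mass converges to a number
      -- strictly above `θ` times the limit mass.
      rcases eq_or_ne (pc a j univ) 0 with h0 | h0
      · simp [h0]
      · refine ((hlim j).eventually_const_lt ?_).mono fun i hi => hi.le
        calc θ * pc a j univ < 1 * pc a j univ :=
              ENNReal.mul_lt_mul_left h0 (measure_ne_top _ _) hθ1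
          _ = _ := one_mul _
    filter_upwards [hev] with i hi
    have hW := W2sq_le_of_pieces (pc (as i)) (pc a) (hsum _ (has i)) (hsum _ ha) (has i) ha
      (fun j : t => Metric.ball (j : Space d) (e / 4)) (δ := ENNReal.ofReal (e / 2)) hθ0 hθ1.le
      (hcar _) (hcar _) (fun j x hx y hy => ?_) hi
    · rw [W2sq_eq_sq] at hW
      refine (ENNReal.pow_le_pow_left_iff two_ne_zero).1 (hW.trans ?_)
      have h1 : (1 : ℝ≥0∞) - θ = ENNReal.ofReal η := by
        rw [hθ, ← ENNReal.ofReal_one, ← ENNReal.ofReal_sub _ (by linarith)]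
        congr 1
        ring
      have hRR : ENNReal.ofReal (R + R) ^ 2 ≤ ENNReal.ofReal ((R + R) ^ 2) := by
        rcases le_total 0 (R + R) with hR | hR
        · rw [ENNReal.ofReal_pow hR]
        · simp [ENNReal.ofReal_of_nonpos hR]
      rw [h1]
      calc ENNReal.ofReal (e / 2) ^ 2 + ENNReal.ofReal (R + R) ^ 2 * ENNReal.ofReal η
          ≤ ENNReal.ofReal ((e / 2) ^ 2) + ENNReal.ofReal ((R + R) ^ 2) * ENNReal.ofReal η := by
            rw [ENNReal.ofReal_pow (by positivity)]
            gcongr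
        _ = ENNReal.ofReal ((e / 2) ^ 2 + (R + R) ^ 2 * η) := by
            rw [ENNReal.ofReal_add (by positivity) (by positivity),
              ENNReal.ofReal_mul (by positivity)]
        _ ≤ ENNReal.ofReal (e ^ 2) := ENNReal.ofReal_le_ofReal (by nlinarith [sq_nonneg e])
        _ = _ := ENNReal.ofReal_pow he.le 2
    · rw [← edist_eq_enorm_sub, edist_dist]
      refine ENNReal.ofReal_le_ofReal ?_
      have := dist_triangle_right x y (j : Space d)
      rw [Metric.mem_ball] at hx hy
      linarith
  rw [ENNReal.tendsto_nhds_zero]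
  intro ε hε
  rcases eq_or_ne ε ∞ with rfl | hε'
  · simp
  · filter_upwards [key ε.toReal (ENNReal.toReal_pos hε.ne' hε')] with i hi
    rwa [ENNReal.ofReal_toReal hε'] at hi

/-! ### Entropic plans are nearly optimal -/

/-- The density is at most `C`, and `log r ≤ r - 1` gives `klFun r = r log r + 1 - r ≤ (r - 1) ^ 2 ≤
C ^ 2 + 1`. -/
lemma klDiv_le_of_le_smul {Ω : Type*} [MeasurableSpace Ω] {μ ν : Measure Ω}
    [IsProbabilityMeasure μ] [IsProbabilityMeasure ν] {C : NNReal} (h : μ ≤ (C : ℝ≥0∞) • ν) :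
    InformationTheory.klDiv μ ν ≤ ENNReal.ofReal ((C : ℝ) ^ 2 + 1) := by
  have hac : μ ≪ ν := Measure.absolutelyContinuous_of_le_smul h
  have hC : ∀ᵐ x ∂ν, μ.rnDeriv ν x ≤ C := by
    refine ae_le_of_forall_setLIntegral_le_of_sigmaFinite (Measure.measurable_rnDeriv _ _)
      fun s _ _ => ?_
    rw [lintegral_const, Measure.restrict_apply_univ]
    exact (Measure.setLIntegral_rnDeriv_le s).trans (h s)
  rw [InformationTheory.klDiv_eq_lintegral_klFun_of_ac hac]
  calc ∫⁻ x, ENNReal.ofReal (InformationTheory.klFun ((μ.rnDeriv ν) x).toReal) ∂ν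
      ≤ ∫⁻ _, ENNReal.ofReal ((C : ℝ) ^ 2 + 1) ∂ν := by
        refine lintegral_mono_ae ?_
        filter_upwards [hC] with x hx
        refine ENNReal.ofReal_le_ofReal ?_
        set r := (μ.rnDeriv ν x).toReal with hr
        have hr0 : 0 ≤ r := ENNReal.toReal_nonneg
        have hrC : r ≤ C := by
          have := ENNReal.toReal_mono ENNReal.coe_ne_top hx
          simpa using this
        rw [InformationTheory.klFun_apply]
        rcases hr0.eq_or_lt with h0 | h0
        · rw [← h0]
          simp
        · have := Real.log_le_sub_one_of_pos h0
          nlinarith [mul_le_mul_of_nonneg_left this hr0]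
    _ = _ := by simp

/-- A Markov kernel leaving `m` invariant, dominated by a multiple of `m`, and moving `m`-almost
every point by at most `δ`. -/
lemma exists_local_kernel (m : Measure (Space d)) [IsProbabilityMeasure m] {r : ℝ}
    (hm : SupportedInBall m r) {δ : ℝ} (hδ : 0 < δ) :
    ∃ κ : Kernel (Space d) (Space d), IsMarkovKernel κ ∧ κ ∘ₘ m = m ∧
      (∃ C : NNReal, ∀ y, κ y ≤ (C : ℝ≥0∞) • m) ∧
      ∀ᵐ y ∂m, ∀ᵐ z ∂κ y, ‖y - z‖ₑ ≤ ENNReal.ofReal δ := by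
  -- The cells are the fibres of the nearest-point map onto finitely many terms of a dense sequence.
  -- Compactness of the ball gives enough terms to make all cells small there.
  obtain ⟨N, hN⟩ : ∃ N : ℕ, ∀ x ∈ Metric.closedBall (0 : Space d) r,
      edist (SimpleFunc.nearestPt (TopologicalSpace.denseSeq (Space d)) N x) x
        ≤ ENNReal.ofReal (δ / 2) := by
    obtain ⟨t, ht⟩ := (isCompact_closedBall (0 : Space d) r).elim_finite_subcover
      (fun k : ℕ => Metric.ball (TopologicalSpace.denseSeq (Space d) k) (δ / 2))
      (fun _ => Metric.isOpen_ball) (fun x _ => by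
        obtain ⟨k, hk⟩ := (TopologicalSpace.denseRange_denseSeq (Space d)).exists_dist_lt x
          (half_pos hδ)
        exact mem_iUnion.2 ⟨k, hk⟩)
    refine ⟨t.sup id, fun x hx => ?_⟩
    obtain ⟨k, hkt, hk⟩ := mem_iUnion₂.1 (ht hx)
    refine (SimpleFunc.edist_nearestPt_le _ x (Finset.le_sup (f := id) hkt)).trans ?_
    rw [edist_comm, edist_dist]
    exact ENNReal.ofReal_le_ofReal (Metric.mem_ball.1 hk).le
  set s := SimpleFunc.nearestPt (TopologicalSpace.denseSeq (Space d)) N with hs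
  classical
  -- Resample from `m` conditioned on the cell. On null cells `m` itself is a default which keeps
  -- the kernel Markov and dominated by `m`.
  set g : Space d → Measure (Space d) := fun v => if m (s ⁻¹' {v}) = 0 then m else m[|s ⁻¹' {v}]
    with hg
  have hcell : ∀ v, MeasurableSet (s ⁻¹' {v}) := fun v => s.measurableSet_fiber v
  have hgm : Measurable fun y => g (s y) := (s.map g).measurable
  have hgp : ∀ v, IsProbabilityMeasure (g v) := fun v => by
    simp only [hg]
    split_ifs with h0
    · infer_instance
    · exact cond_isProbabilityMeasure h0
  have hnull : ∀ᵐ y ∂m, m (s ⁻¹' {s y}) ≠ 0 := by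
    have : ∀ v ∈ s.range, ∀ᵐ y ∂m, s y = v → m (s ⁻¹' {v}) ≠ 0 := fun v _ => by
      by_cases h0 : m (s ⁻¹' {v}) = 0
      · have h1 : ∀ᵐ y ∂m, y ∉ s ⁻¹' {v} := measure_eq_zero_iff_ae_notMem.1 h0
        filter_upwards [h1] with y hy hv
        exact absurd hv hy
      · exact .of_forall fun y _ => h0
    have h2 := (ae_ball_iff s.range.countable_toSet).2 this
    filter_upwards [h2] with y hy
    exact hy (s y) (s.mem_range_self y) rfl
  refine ⟨⟨fun y => g (s y), hgm⟩, ⟨fun y => hgp _⟩, ?_, ?_, ?_⟩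
  · ext B hB
    rw [Measure.bind_apply hB (Kernel.aemeasurable _)]
    change ∫⁻ y, g (s y) B ∂m = m B
    calc ∫⁻ y, g (s y) B ∂m = ∫⁻ y, (s.map fun v => g v B) y ∂m := rfl
      _ = ∑ v ∈ s.range, g v B * m (s ⁻¹' {v}) := by
          rw [SimpleFunc.lintegral_eq_lintegral, SimpleFunc.map_lintegral]
      _ = ∑ v ∈ s.range, (m.restrict B) (s ⁻¹' {v}) := by
          refine Finset.sum_congr rfl fun v _ => ?_
          rw [Measure.restrict_apply (hcell v)]
          by_cases h0 : m (s ⁻¹' {v}) = 0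
          · rw [h0, mul_zero, measure_mono_null inter_subset_left h0]
          · simp only [hg, if_neg h0]
            rw [cond_apply (hcell v), mul_comm, ← mul_assoc,
              ENNReal.mul_inv_cancel h0 (measure_ne_top _ _), one_mul]
      _ = m B := by
          rw [SimpleFunc.sum_range_measure_preimage_singleton, Measure.restrict_apply_univ]
  -- The summand `1` handles the default on null cells; elsewhere conditioning multiplies `m` by at
  -- most the inverse mass of the cell.
  · refine ⟨1 + ∑ v ∈ s.range, (m (s ⁻¹' {v}))⁻¹.toNNReal, fun y => ?_⟩
    change g (s y) ≤ _
    simp only [hg]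
    split_ifs with h0
    · refine Measure.le_intro fun B _ _ => ?_
      rw [Measure.smul_apply, smul_eq_mul]
      refine le_mul_of_one_le_left' ?_
      exact_mod_cast le_self_add
    · refine Measure.le_intro fun B _ _ => ?_
      rw [cond_apply (hcell _), Measure.smul_apply, smul_eq_mul]
      gcongr
      · have h1 : (m (s ⁻¹' {s y}))⁻¹ = ((m (s ⁻¹' {s y}))⁻¹.toNNReal : ℝ≥0∞) :=
          (ENNReal.coe_toNNReal (ENNReal.inv_ne_top.2 h0)).symm
        rw [h1]
        refine ENNReal.coe_le_coe.2 (le_add_of_nonneg_of_le zero_le_one ?_)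
        exact Finset.single_le_sum (f := fun v => (m (s ⁻¹' {v}))⁻¹.toNNReal)
          (fun _ _ => zero_le) (s.mem_range_self y)
      · exact inter_subset_right
  · have hball := ae_norm_le_of_supportedInBall hm
    filter_upwards [hnull, hball] with y hy hyr
    change ∀ᵐ z ∂g (s y), _
    simp only [hg, if_neg hy]
    have h1 : ∀ᵐ z ∂m[|s ⁻¹' {s y}], z ∈ s ⁻¹' {s y} := ae_cond_mem (hcell _)
    have h2 : ∀ᵐ z ∂m[|s ⁻¹' {s y}], ‖z‖ ≤ r := cond_absolutelyContinuous hball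
    filter_upwards [h1, h2] with z hz hzr
    rw [← edist_eq_enorm_sub]
    have e1 := hN y (by simpa using hyr)
    have e2 := hN z (by simpa using hzr)
    rw [mem_preimage, mem_singleton_iff] at hz
    rw [hz] at e2
    calc edist y z ≤ edist (s y) y + edist (s y) z := edist_triangle_left _ _ _
      _ ≤ ENNReal.ofReal (δ / 2) + ENNReal.ofReal (δ / 2) := add_le_add e1 e2
      _ = ENNReal.ofReal δ := by
          rw [← ENNReal.ofReal_add (by positivity) (by positivity), add_halves]

/-- Every plan can be modified into a plan of controlled entropy and nearly the same cost. -/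
lemma exists_plan_klDiv_le (m : Measure (Space d)) [IsProbabilityMeasure m] {r : ℝ}
    (hm : SupportedInBall m r) {δ : ℝ} (hδ : 0 < δ) :
    ∃ K : NNReal, ∀ (a : Measure (Space d)) [IsProbabilityMeasure a], ∀ γ ∈ plans a m,
      ∃ γ' ∈ plans a m, InformationTheory.klDiv γ' (a.prod m) ≤ K ∧
        eLpNorm (fun p : Space d × Space d => p.1 - p.2) 2 γ'
          ≤ eLpNorm (fun p : Space d × Space d => p.1 - p.2) 2 γ + ENNReal.ofReal δ := by
  obtain ⟨κ, hκ, hinv, ⟨C, hC⟩, hloc⟩ := exists_local_kernel m hm hδ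
  refine ⟨Real.toNNReal ((C : ℝ) ^ 2 + 1), fun a _ γ hγ => ?_⟩
  have := isProbabilityMeasure_of_mem_plans hγ
  -- From `(x, y)` draw `z` with law `κ y`; the new plan is the law of `(x, z)`. Invariance of `m`
  -- under `κ` preserves the second marginal.
  set π := γ ⊗ₘ (κ.comap Prod.snd measurable_snd) with hπ
  have h12 : π.map Prod.fst = γ := Measure.fst_compProd _ _
  have hmeas : Measurable fun q : (Space d × Space d) × Space d => (q.1.1, q.2) := by fun_prop
  have happ : ∀ S, MeasurableSet S → (π.map fun q => (q.1.1, q.2)) S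
      = ∫⁻ p, κ p.2 (Prod.mk p.1 ⁻¹' S) ∂γ := fun S hS => by
    rw [Measure.map_apply hmeas hS, Measure.compProd_apply (hmeas hS)]
    rfl
  have hpl : (π.map fun q => (q.1.1, q.2)) ∈ plans a m := by
    constructor
    · rw [Measure.fst_map_prodMk (by fun_prop), ← hγ.1, Measure.fst, ← h12,
        Measure.map_map (by fun_prop) (by fun_prop)]
      rfl
    · ext B hB
      rw [Measure.snd_apply hB, happ _ (measurable_snd hB)]
      change ∫⁻ p, κ p.2 B ∂γ = m B
      conv_rhs => rw [← hinv, Measure.bind_apply hB (Kernel.aemeasurable _), ← hγ.2, Measure.snd,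
        lintegral_map (Kernel.measurable_coe κ hB) measurable_snd]
  have := isProbabilityMeasure_of_mem_plans hpl
  refine ⟨_, hpl, ?_, ?_⟩
  -- Averaging `κ y ≤ C • m` over `γ` shows that the new plan is dominated by `C • (a ⊗ m)`,
  -- whatever `γ` was.
  · refine klDiv_le_of_le_smul (C := C) (Measure.le_intro fun S hS _ => ?_)
    rw [happ S hS, Measure.smul_apply, smul_eq_mul, Measure.prod_apply hS, ← hγ.1, Measure.fst,
      lintegral_map (measurable_measure_prodMk_left hS) measurable_fst,
      ← lintegral_const_mul' _ _ ENNReal.coe_ne_top]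
    exact lintegral_mono fun p => hC p.2 _
  · rw [eLpNorm_map_measure (by fun_prop) (by fun_prop)]
    have e1 : eLpNorm (fun q : (Space d × Space d) × Space d => q.1.1 - q.1.2) 2 π
        = eLpNorm (fun p : Space d × Space d => p.1 - p.2) 2 γ := by
      rw [← h12, eLpNorm_map_measure (by fun_prop) (by fun_prop)]
      rfl
    have e2 : eLpNorm (fun q : (Space d × Space d) × Space d => q.1.2 - q.2) 2 π
        ≤ ENNReal.ofReal δ := by
      have hae : ∀ᵐ q ∂π, ‖q.1.2 - q.2‖ₑ ≤ ENNReal.ofReal δ := by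
        refine Measure.ae_compProd_of_ae_ae
          (measurableSet_le (by fun_prop) measurable_const) ?_
        exact ae_snd_of_mem_plans hγ hloc
      calc eLpNorm (fun q : (Space d × Space d) × Space d => q.1.2 - q.2) 2 π
          ≤ eLpNorm (fun _ : (Space d × Space d) × Space d => δ) 2 π := by
            refine eLpNorm_mono_ae ?_
            filter_upwards [hae] with q hq
            rw [← ofReal_norm, ENNReal.ofReal_le_ofReal_iff hδ.le] at hq
            rwa [Real.norm_of_nonneg hδ.le]
        _ = ENNReal.ofReal δ := by
            rw [eLpNorm_const _ (by norm_num) (IsProbabilityMeasure.ne_zero π), measure_univ,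
              ENNReal.one_rpow, mul_one, Real.enorm_of_nonneg hδ.le]
    refine le_trans ?_ (add_le_add e1.le e2)
    refine le_of_eq_of_le ?_ (eLpNorm_add_le (by fun_prop) (by fun_prop) (by norm_num))
    congr 1
    ext q : 1
    simp

/-- Minimality against the competitor `γ'`, dropping the nonnegative entropy of `γ`; the factor `2`
undoes the `½` of the cost. -/
lemma IsEntropicPlan.quadCost_le {ε : ℝ} {a m : Measure (Space d)}
    {γ γ' : Measure (Space d × Space d)} (h : IsEntropicPlan ε a m γ) (h' : γ' ∈ plans a m) :
    quadCost γ ≤ quadCost γ' + 2 * (ENNReal.ofReal ε * InformationTheory.klDiv γ' (a.prod m)) := by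
  have h1 : entropicCost ε a m γ ≤ entropicCost ε a m γ' := by
    rw [h.2]
    exact iInf₂_le γ' h'
  have h2 : 2⁻¹ * quadCost γ ≤ entropicCost ε a m γ' := le_trans le_self_add h1
  calc quadCost γ = 2 * (2⁻¹ * quadCost γ) := by
        rw [← mul_assoc, ENNReal.mul_inv_cancel (by norm_num) (by norm_num), one_mul]
    _ ≤ 2 * entropicCost ε a m γ' := by gcongr
    _ = _ := by
        rw [entropicCost, mul_add, ← mul_assoc,
          ENNReal.mul_inv_cancel (by norm_num) (by norm_num), one_mul]

/-- `K` is chosen before `ε` and `a`, so the error is uniform along a curve. Half of `δ` pays for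
choosing a nearly optimal plan and half for smearing it. -/
lemma exists_quadCost_le_of_isEntropicPlan (m : Measure (Space d)) [IsProbabilityMeasure m] {r : ℝ}
    (hm : SupportedInBall m r) {δ : ℝ} (hδ : 0 < δ) :
    ∃ K : NNReal, ∀ (ε : ℝ) (a : Measure (Space d)) [IsProbabilityMeasure a],
      ∀ γ, IsEntropicPlan ε a m γ → quadCost γ ≤ (W2 a m + ENNReal.ofReal δ) ^ 2
        + ENNReal.ofReal ε * K := by
  obtain ⟨K, hK⟩ := exists_plan_klDiv_le m hm (half_pos hδ)
  refine ⟨2 * K, fun ε a _ γ hγ => ?_⟩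
  rcases eq_or_ne (W2 a m) ∞ with htop | htop
  · simp [htop]
  obtain ⟨γ₁, h₁, hlt⟩ := exists_plan_eLpNorm_lt
    (ENNReal.lt_add_right htop (by simpa using hδ : ENNReal.ofReal (δ / 2) ≠ 0))
  obtain ⟨γ', h', hkl, hle⟩ := hK a γ₁ h₁
  refine (hγ.quadCost_le h').trans ?_
  rw [quadCost_eq_eLpNorm_sq]
  have : eLpNorm (fun p : Space d × Space d => p.1 - p.2) 2 γ' ≤ W2 a m + ENNReal.ofReal δ := by
    refine hle.trans ((add_le_add_left hlt.le _).trans_eq ?_)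
    rw [add_assoc, ← ENNReal.ofReal_add (by positivity) (by positivity), add_halves]
  refine add_le_add (by gcongr) ?_
  calc 2 * (ENNReal.ofReal ε * InformationTheory.klDiv γ' (a.prod m))
      ≤ 2 * (ENNReal.ofReal ε * K) := by gcongr
    _ = ENNReal.ofReal ε * ↑(2 * K) := by
        push_cast
        ring

/-! ### Weak convergence of probability measures -/

section WeakConvergence

variable {X : Type*} [PseudoMetricSpace X] [MeasurableSpace X] [BorelSpace X]

/-- Portmanteau inequality for the open set `Kᶜ`. -/
lemma measure_compl_eq_zero_of_tendsto {ι : Type*} {l : Filter ι} [l.NeBot]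
    {ms : ι → ProbabilityMeasure X} {m : ProbabilityMeasure X} (h : Tendsto ms l (𝓝 m))
    {K : Set X} (hK : IsClosed K) (hms : ∀ᶠ i in l, (ms i : Measure X) Kᶜ = 0) :
    (m : Measure X) Kᶜ = 0 := by
  have h1 := ProbabilityMeasure.le_liminf_measure_open_of_tendsto h hK.isOpen_compl
  refine nonpos_iff_eq_zero.1 (h1.trans_eq ?_)
  refine Tendsto.liminf_eq (tendsto_const_nhds.congr' ?_)
  filter_upwards [hms] with i hi
  exact hi.symm

lemma integrable_of_isCompact {m : Measure X} [IsFiniteMeasure m] {K : Set X} [T2Space X]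
    (hK : IsCompact K) (hm : m Kᶜ = 0) {g : X → ℝ} (hg : Continuous g) : Integrable g m := by
  have hae : ∀ᵐ x ∂m, x ∈ K := hm
  rw [← Measure.restrict_eq_self_of_ae_mem hae]
  exact hg.continuousOn.integrableOn_compact hK

/-- Weak convergence of measures carried by a fixed compact set may be tested against arbitrary
continuous functions. -/
lemma tendsto_integral_of_isCompact {ι : Type*} {l : Filter ι}
    {ms : ι → ProbabilityMeasure X} {m : ProbabilityMeasure X} (h : Tendsto ms l (𝓝 m))
    {K : Set X} (hK : IsCompact K) (hms : ∀ i, (ms i : Measure X) Kᶜ = 0)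
    (hm : (m : Measure X) Kᶜ = 0) {g : X → ℝ} (hg : Continuous g) :
    Tendsto (fun i => ∫ x, g x ∂(ms i : Measure X)) l (𝓝 (∫ x, g x ∂(m : Measure X))) := by
  obtain ⟨C, hC⟩ := hK.exists_bound_of_continuousOn hg.continuousOn
  -- Truncation at heights `±C` makes `g` bounded and leaves it unchanged on `K`.
  have hcl : Continuous fun x => max (-C) (min (g x) C) := by fun_prop
  set G : BoundedContinuousFunction X ℝ :=
    BoundedContinuousFunction.ofNormedAddCommGroup (fun x => max (-C) (min (g x) C)) hcl |C|
      (fun x => by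
        rw [Real.norm_eq_abs, abs_le]
        constructor
        · exact (neg_le_neg (le_abs_self C)).trans (le_max_left _ _)
        · refine max_le (neg_le_abs C) ((min_le_right _ _).trans (le_abs_self C))) with hG
  have hGg : ∀ m' : Measure X, m' Kᶜ = 0 → ∫ x, G x ∂m' = ∫ x, g x ∂m' := fun m' hm' => by
    have hae : ∀ᵐ x ∂m', x ∈ K := hm'
    refine integral_congr_ae ?_
    filter_upwards [hae] with x hx
    have := abs_le.1 (hC x hx)
    simp only [hG, BoundedContinuousFunction.coe_ofNormedAddCommGroup]
    rw [min_eq_left this.2, max_eq_right this.1]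
  have h1 := ProbabilityMeasure.tendsto_iff_forall_integral_tendsto.1 h G
  rw [hGg _ hm] at h1
  simpa only [hGg _ (hms _)] using h1

end WeakConvergence

/-- Bounded Lipschitz functions suffice to test weak convergence, and `enorm_integral_sub_le_W2`
controls their integrals. -/
lemma tendsto_of_tendsto_W2 {ι : Type*} {l : Filter ι} {as : ι → ProbabilityMeasure (Space d)}
    {a : ProbabilityMeasure (Space d)}
    (h : Tendsto (fun i => W2 (as i : Measure (Space d)) a) l (𝓝 0)) :
    Tendsto as l (𝓝 a) := by
  -- The Lipschitz criterion is applied along the largest filter on which `W2` to `a` tends to `0`.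
  -- That filter is countably generated, whereas `l` may be an ultrafilter.
  have key : Tendsto id (comap (fun m : ProbabilityMeasure (Space d) =>
      W2 (m : Measure (Space d)) a) (𝓝 0)) (𝓝 a) := by
    rw [tendsto_iff_forall_lipschitz_integral_tendsto]
    rintro f ⟨C, hC⟩ ⟨L, hL⟩
    rw [tendsto_iff_edist_tendsto_0]
    have hb : ∀ x, ‖f x‖ ≤ C + ‖f 0‖ := fun x => by
      have h1 := hC x 0
      rw [dist_eq_norm] at h1
      have h2 := norm_add_le (f x - f 0) (f 0)
      rw [sub_add_cancel] at h2
      linarith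
    have hlim : Tendsto (fun m : ProbabilityMeasure (Space d) => L * W2 (m : Measure (Space d)) a)
        (comap (fun m : ProbabilityMeasure (Space d) =>
          W2 (m : Measure (Space d)) a) (𝓝 0)) (𝓝 0) := by
      have := ENNReal.Tendsto.const_mul (a := (L : ℝ≥0∞)) tendsto_comap
        (f := comap (fun m : ProbabilityMeasure (Space d) => W2 (m : Measure (Space d)) a) (𝓝 0))
        (m := fun m : ProbabilityMeasure (Space d) => W2 (m : Measure (Space d)) a)
        (Or.inr ENNReal.coe_ne_top)
      rwa [mul_zero] at this
    refine tendsto_of_tendsto_of_tendsto_of_le_of_le tendsto_const_nhds hlim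
      (fun _ => zero_le) fun m => ?_
    rw [edist_eq_enorm_sub]
    exact enorm_integral_sub_le_W2 hL ⟨_, hb⟩
  exact key.comp (tendsto_comap_iff.2 h)

/-- The constant sequence `a` converges weakly to `b`, so uniqueness of limits gives equality. -/
lemma ext_of_forall_lipschitz {X : Type*} [MetricSpace X] [MeasurableSpace X]
    [BorelSpace X] {a b : ProbabilityMeasure X}
    (h : ∀ (f : X → ℝ) (L : NNReal), (∃ C, ∀ x, ‖f x‖ ≤ C) → LipschitzWith L f →
      ∫ x, f x ∂(a : Measure X) = ∫ x, f x ∂(b : Measure X)) : a = b := by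
  have : Tendsto (fun _ : ℕ => a) atTop (𝓝 b) := by
    rw [tendsto_iff_forall_lipschitz_integral_tendsto]
    rintro f ⟨C, hC⟩ ⟨L, hL⟩
    rcases isEmpty_or_nonempty X with hX | ⟨⟨x0⟩⟩
    · exact (a.nonempty.elim fun x => (hX.false x).elim)
    have hb : ∀ x, ‖f x‖ ≤ C + ‖f x0‖ := fun x => by
      have h1 := hC x x0
      rw [dist_eq_norm] at h1
      have h2 := norm_add_le (f x - f x0) (f x0)
      rw [sub_add_cancel] at h2
      linarith
    rw [h f L ⟨_, hb⟩ hL]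
    exact tendsto_const_nhds
  exact tendsto_nhds_unique tendsto_const_nhds this

/-- A weakly continuous curve of probability measures is measurable. -/
lemma measurable_of_continuous_probabilityMeasure {α : ℝ → ProbabilityMeasure (Space d)}
    (h : Continuous α) : Measurable fun t => (α t : Measure (Space d)) := by
  refine Measurable.measure_of_isPiSystem_of_isProbabilityMeasure
    (S := {s | IsOpen s}) BorelSpace.measurable_eq isPiSystem_isOpen fun G hG => ?_
  -- For open `G`, the map `t ↦ α t G` is lower semicontinuous by the portmanteau inequality.
  refine LowerSemicontinuous.measurable (lowerSemicontinuous_iff_le_liminf.2 fun t => ?_)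
  exact ProbabilityMeasure.le_liminf_measure_open_of_tendsto (h.tendsto t) hG

/-! ### The normalized Lebesgue measure on the time interval -/

/-- The normalized Lebesgue measure on `[0, T]`. -/
noncomputable def timeMeasure (T : ℝ) : Measure ℝ :=
  (ENNReal.ofReal T)⁻¹ • volume.restrict (Icc 0 T)

instance isProbabilityMeasure_timeMeasure {T : ℝ} [hT : Fact (0 < T)] :
    IsProbabilityMeasure (timeMeasure T) := by
  refine ⟨?_⟩
  rw [timeMeasure, Measure.smul_apply, Measure.restrict_apply_univ, Real.volume_Icc, sub_zero,
    smul_eq_mul, ENNReal.inv_mul_cancel (by simpa using hT.out) ENNReal.ofReal_ne_top]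

lemma ae_timeMeasure_iff {T : ℝ} {p : ℝ → Prop} :
    (∀ᵐ t ∂timeMeasure T, p t) ↔ ∀ᵐ t ∂volume.restrict (Icc 0 T), p t := by
  rw [timeMeasure, Measure.ae_ennreal_smul_measure_iff (ENNReal.inv_ne_zero.2 ENNReal.ofReal_ne_top)]

lemma ae_timeMeasure_mem {T : ℝ} : ∀ᵐ t ∂timeMeasure T, t ∈ Icc 0 T :=
  ae_timeMeasure_iff.2 (ae_restrict_mem measurableSet_Icc)

lemma intervalIntegral_eq_timeMeasure {T : ℝ} (hT : 0 < T) (g : ℝ → ℝ) :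
    ∫ t in (0 : ℝ)..T, g t = T * ∫ t, g t ∂timeMeasure T := by
  rw [timeMeasure, integral_smul_measure, ENNReal.toReal_inv, ENNReal.toReal_ofReal hT.le,
    intervalIntegral.integral_of_le hT.le, ← integral_Icc_eq_integral_Ioc, smul_eq_mul, ← mul_assoc,
    mul_inv_cancel₀ hT.ne', one_mul]

/-- Plans are only known to be probabilities for a.e. `t`; putting a Dirac mass at the other times
makes `dt ⊗ γ_t` a probability measure after normalization. -/
lemma exists_markov_ae_eq {T : ℝ} (γ : Kernel ℝ (Space d × Space d))
    (h : ∀ᵐ t ∂timeMeasure T, IsProbabilityMeasure (γ t)) :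
    ∃ γ' : Kernel ℝ (Space d × Space d), IsMarkovKernel γ' ∧ ∀ᵐ t ∂timeMeasure T, γ' t = γ t := by
  classical
  have hm : MeasurableSet {t | IsProbabilityMeasure (γ t)} :=
    γ.measurable ProbabilityMeasure.measurableSet_isProbabilityMeasure
  refine ⟨Kernel.piecewise hm γ (Kernel.const ℝ (Measure.dirac 0)), ⟨fun t => ?_⟩, ?_⟩
  · rw [Kernel.piecewise_apply]
    split_ifs with ht
    · exact ht
    · rw [Kernel.const_apply]
      infer_instance
  · filter_upwards [h] with t ht
    rw [Kernel.piecewise_apply]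
    exact if_pos ht

/-! ### The weak equation in terms of the measure `dt ⊗ γ_t` -/

/-- The compact set carrying the measures `dt ⊗ γ_t`. -/
def carrier (d : ℕ) (T R r : ℝ) : Set (ℝ × Space d × Space d) :=
  Icc 0 T ×ˢ (Metric.closedBall 0 R ×ˢ Metric.closedBall 0 r)

lemma isCompact_carrier (T R r : ℝ) : IsCompact (carrier d T R r) :=
  isCompact_Icc.prod ((isCompact_closedBall _ _).prod (isCompact_closedBall _ _))

lemma measure_compl_carrier {T R r : ℝ} [Fact (0 < T)] {γ : Kernel ℝ (Space d × Space d)}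
    [IsMarkovKernel γ] {α : ℝ → ProbabilityMeasure (Space d)} {m : Measure (Space d)}
    (hα : ∀ t ∈ Icc 0 T, SupportedInBall (α t : Measure (Space d)) R) (hm : SupportedInBall m r)
    (hγ : ∀ᵐ t ∂timeMeasure T, γ t ∈ plans (α t : Measure (Space d)) m) :
    (timeMeasure T ⊗ₘ γ) (carrier d T R r)ᶜ = 0 := by
  have : ∀ᵐ q ∂(timeMeasure T ⊗ₘ γ), q ∈ carrier d T R r := by
    refine Measure.ae_compProd_of_ae_ae (isCompact_carrier T R r).measurableSet ?_
    filter_upwards [hγ, ae_timeMeasure_mem] with t ht htT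
    filter_upwards [ae_fst_of_mem_plans ht (ae_norm_le_of_supportedInBall (hα t htT)),
      ae_snd_of_mem_plans ht (ae_norm_le_of_supportedInBall hm)] with p h1 h2
    exact ⟨htT, by simpa using h1, by simpa using h2⟩
  exact this

/-- The derivative of `f` along the field `(1, A (x - y))`. -/
noncomputable def transportDeriv (A : Space d →L[ℝ] Space d) (f : ℝ × Space d → ℝ)
    (q : ℝ × Space d × Space d) : ℝ :=
  fderiv ℝ f (q.1, q.2.1) (1, A (q.2.1 - q.2.2))

lemma continuous_fderiv_apply_comp {f : ℝ × Space d → ℝ} (hf : ContDiff ℝ 1 f) {X : Type*}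
    [TopologicalSpace X] {u v : X → ℝ × Space d} (hu : Continuous u) (hv : Continuous v) :
    Continuous fun x => fderiv ℝ f (u x) (v x) :=
  ((hf.continuous_fderiv one_ne_zero).comp hu).clm_apply hv

lemma continuous_transportDeriv {A : Space d →L[ℝ] Space d} {f : ℝ × Space d → ℝ}
    (hf : ContDiff ℝ 1 f) : Continuous (transportDeriv A f) :=
  continuous_fderiv_apply_comp hf (by fun_prop) (by fun_prop)

lemma deriv_slice {f : ℝ × Space d → ℝ} (hf : ContDiff ℝ 1 f) (t : ℝ) (x : Space d) :
    deriv (fun s => f (s, x)) t = fderiv ℝ f (t, x) (1, 0) := by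
  have h1 : HasFDerivAt f (fderiv ℝ f (t, x)) (t, x) :=
    (hf.differentiable one_ne_zero _).hasFDerivAt
  have h2 : HasDerivAt (fun s : ℝ => (s, x)) ((1 : ℝ), (0 : Space d)) t :=
    (hasDerivAt_id t).prodMk (hasDerivAt_const t x)
  exact (h1.comp_hasDerivAt t h2).deriv

lemma inner_gradient_slice {f : ℝ × Space d → ℝ} (hf : ContDiff ℝ 1 f) (t : ℝ) (x v : Space d) :
    inner ℝ v (gradient (fun z => f (t, z)) x) = fderiv ℝ f (t, x) (0, v) := by
  have h1 : HasFDerivAt f (fderiv ℝ f (t, x)) (t, x) :=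
    (hf.differentiable one_ne_zero _).hasFDerivAt
  have h2 : HasFDerivAt (fun z : Space d => (t, z)) (ContinuousLinearMap.inr ℝ ℝ (Space d)) x :=
    (hasFDerivAt_prodMk_right t x)
  have h3 := (h1.comp x h2).fderiv
  rw [gradient, real_inner_comm, InnerProductSpace.toDual_symm_apply]
  change fderiv ℝ (f ∘ fun z => (t, z)) x v = _
  rw [h3]
  simp

/-- The integral over `α t` lifts to `γ t`, whose first marginal it is. The velocity terms then
combine into one continuous integrand. The factor `T` undoes the normalization of `timeMeasure`. -/
lemma weakEquation_iff {T R r : ℝ} [hT : Fact (0 < T)] {A : Space d →L[ℝ] Space d}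
    {α₀ m : Measure (Space d)} {α : ℝ → ProbabilityMeasure (Space d)}
    {γ : Kernel ℝ (Space d × Space d)} [IsMarkovKernel γ]
    (hα : ∀ t ∈ Icc 0 T, SupportedInBall (α t : Measure (Space d)) R) (hm : SupportedInBall m r)
    (hγ : ∀ᵐ t ∂timeMeasure T, γ t ∈ plans (α t : Measure (Space d)) m) :
    WeakEquation T A α₀ α γ ↔ ∀ f : ℝ × Space d → ℝ, ContDiff ℝ 1 f →
      T * ∫ q, transportDeriv A f q ∂(timeMeasure T ⊗ₘ γ)
        = (∫ x, f (T, x) ∂(α T : Measure (Space d))) - ∫ x, f (0, x) ∂α₀ := by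
  refine forall₂_congr fun f hf => ?_
  have hK := measure_compl_carrier hα hm hγ
  set g₁ : ℝ × Space d × Space d → ℝ := fun q => fderiv ℝ f (q.1, q.2.1) (1, A q.2.1) with hg₁
  set g₂ : ℝ × Space d × Space d → ℝ := fun q => fderiv ℝ f (q.1, q.2.1) (0, A q.2.2) with hg₂
  have c₁ : Continuous g₁ := continuous_fderiv_apply_comp hf (by fun_prop) (by fun_prop)
  have c₂ : Continuous g₂ := continuous_fderiv_apply_comp hf (by fun_prop) (by fun_prop)
  have i₁ := integrable_of_isCompact (isCompact_carrier T R r) hK c₁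
  have i₂ := integrable_of_isCompact (isCompact_carrier T R r) hK c₂
  have e₁ : ∫ t in (0 : ℝ)..T, ∫ x,
        (deriv (fun s => f (s, x)) t + inner ℝ (A x) (gradient (fun z => f (t, z)) x))
          ∂(α t : Measure (Space d)) = T * ∫ q, g₁ q ∂(timeMeasure T ⊗ₘ γ) := by
    rw [intervalIntegral_eq_timeMeasure hT.out, Measure.integral_compProd i₁]
    congr 1
    refine integral_congr_ae ?_
    filter_upwards [hγ] with t ht
    have hc : Continuous fun x => fderiv ℝ f (t, x) (1, A x) :=
      continuous_fderiv_apply_comp hf (by fun_prop) (by fun_prop)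
    rw [← ht.1, Measure.fst]
    simp_rw [deriv_slice hf, inner_gradient_slice hf, ← map_add, Prod.mk_add_mk, zero_add, add_zero]
    rw [integral_map measurable_fst.aemeasurable hc.aestronglyMeasurable]
  have e₂ : ∫ t in (0 : ℝ)..T, ∫ p, inner ℝ (A p.2) (gradient (fun z => f (t, z)) p.1) ∂(γ t)
      = T * ∫ q, g₂ q ∂(timeMeasure T ⊗ₘ γ) := by
    rw [intervalIntegral_eq_timeMeasure hT.out, Measure.integral_compProd i₂]
    simp_rw [inner_gradient_slice hf]
    rfl
  rw [e₁, e₂, ← mul_sub, ← integral_sub i₁ i₂]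
  have : (fun q => g₁ q - g₂ q) = transportDeriv A f := by
    ext q
    rw [hg₁, hg₂, transportDeriv, ← map_sub]
    simp
  rw [this]

/-! ### Stability of weak solutions with nearly optimal plans -/

lemma W2_le_uniformW2 {T : ℝ} (α β : ℝ → ProbabilityMeasure (Space d)) {t : ℝ}
    (ht : t ∈ Icc 0 T) : W2 (α t : Measure (Space d)) (β t) ≤ uniformW2 T α β :=
  le_iSup₂ (f := fun t (_ : t ∈ Icc 0 T) => W2 (α t : Measure (Space d)) (β t)) t ht

lemma tendsto_W2_of_uniformW2 {ι : Type*} {l : Filter ι} {T : ℝ}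
    {αs : ι → ℝ → ProbabilityMeasure (Space d)} {α : ℝ → ProbabilityMeasure (Space d)}
    (h : Tendsto (fun i => uniformW2 T (αs i) α) l (𝓝 0)) {t : ℝ} (ht : t ∈ Icc 0 T) :
    Tendsto (fun i => W2 (αs i t : Measure (Space d)) (α t)) l (𝓝 0) :=
  tendsto_of_tendsto_of_tendsto_of_le_of_le tendsto_const_nhds h (fun _ => zero_le)
    fun i => W2_le_uniformW2 (αs i) α ht

lemma W2Continuous.of_uniformW2 {ι : Type*} {l : Filter ι} [l.NeBot] {T : ℝ}
    {αs : ι → ℝ → ProbabilityMeasure (Space d)} {α : ℝ → ProbabilityMeasure (Space d)}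
    (h : Tendsto (fun i => uniformW2 T (αs i) α) l (𝓝 0)) (hc : ∀ i, W2Continuous T (αs i)) :
    W2Continuous T α := by
  intro t ht
  rw [ENNReal.tendsto_nhds_zero]
  intro ε hε
  have h3 : 0 < ε / 3 := ENNReal.div_pos hε.ne' (by norm_num)
  obtain ⟨i, hi⟩ := (ENNReal.tendsto_nhds_zero.1 h (ε / 3) h3).exists
  filter_upwards [ENNReal.tendsto_nhds_zero.1 (hc i t ht) (ε / 3) h3, self_mem_nhdsWithin]
    with s hs hsT
  calc W2 (α s : Measure (Space d)) (α t)
      ≤ W2 (α s : Measure (Space d)) (αs i s) + W2 (αs i s : Measure (Space d)) (α t) :=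
        W2_triangle _ _ _
    _ ≤ W2 (α s : Measure (Space d)) (αs i s)
        + (W2 (αs i s : Measure (Space d)) (αs i t) + W2 (αs i t : Measure (Space d)) (α t)) := by
        gcongr
        exact W2_triangle _ _ _
    _ ≤ ε / 3 + (ε / 3 + ε / 3) := by
        gcongr
        · rw [W2_comm]
          exact (W2_le_uniformW2 _ _ hsT).trans hi
        · exact (W2_le_uniformW2 _ _ ht).trans hi
    _ = ε := by rw [← add_assoc, ENNReal.add_thirds]

lemma W2Continuous.continuousOn {T : ℝ} {α : ℝ → ProbabilityMeasure (Space d)}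
    (h : W2Continuous T α) : ContinuousOn α (Icc 0 T) :=
  fun t ht => tendsto_of_tendsto_W2 (h t ht)

/-- Nothing is known outside `[0, T]`, so the curve is extended by its endpoint values. -/
lemma W2Continuous.exists_kernel {T : ℝ} (hT : 0 < T) {α : ℝ → ProbabilityMeasure (Space d)}
    (h : W2Continuous T α) : ∃ κ : Kernel ℝ (Space d), IsMarkovKernel κ ∧
      ∀ t ∈ Icc 0 T, κ t = α t := by
  have hc : Continuous fun t : ℝ => α (projIcc 0 T hT.le t) :=
    h.continuousOn.comp_continuous (continuous_subtype_val.comp continuous_projIcc)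
      fun t => (projIcc 0 T hT.le t).2
  refine ⟨⟨_, measurable_of_continuous_probabilityMeasure hc⟩, ⟨fun t => ?_⟩, fun t ht => ?_⟩
  · change IsProbabilityMeasure (α (projIcc 0 T hT.le t) : Measure (Space d))
    infer_instance
  · change (α (projIcc 0 T hT.le t) : Measure (Space d)) = α t
    rw [projIcc_of_mem hT.le ht]

/-- The probability measure `T⁻¹ dt ⊗ γ_t` on `[0, T] × ℝ^d × ℝ^d`. -/
noncomputable def jointMeasure (T : ℝ) [Fact (0 < T)] (γ : Kernel ℝ (Space d × Space d))
    [IsMarkovKernel γ] : ProbabilityMeasure (ℝ × Space d × Space d) :=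
  ⟨timeMeasure T ⊗ₘ γ, inferInstance⟩

lemma coe_jointMeasure (T : ℝ) [Fact (0 < T)] (γ : Kernel ℝ (Space d × Space d))
    [IsMarkovKernel γ] : (jointMeasure T γ : Measure (ℝ × Space d × Space d)) = timeMeasure T ⊗ₘ γ :=
  rfl

lemma integrable_integral_of_compProd {X Y : Type*} [MeasurableSpace X] [MeasurableSpace Y]
    {m : Measure X} [SFinite m] {κ : Kernel X Y} [IsSFiniteKernel κ] {f : X × Y → ℝ}
    (hf : Integrable f (m ⊗ₘ κ)) : Integrable (fun x => ∫ y, f (x, y) ∂(κ x)) m := by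
  have := Integrable.integral_compProd hf
  simpa using this

/-! ### Disintegration and marginals of a weak limit of plans. -/

section Limit

variable {ι : Type*} {l : Filter ι} [l.NeBot] {T : ℝ} [hT : Fact (0 < T)]
  {γs : ι → Kernel ℝ (Space d × Space d)} [∀ i, IsMarkovKernel (γs i)]
  {Γ : ProbabilityMeasure (ℝ × Space d × Space d)}

/-- The time marginal is the same for all `i`, hence also for the limit `Γ`. -/
lemma timeMeasure_compProd_condKernel (hΓ : Tendsto (fun i => jointMeasure T (γs i)) l (𝓝 Γ)) :
    timeMeasure T ⊗ₘ (Γ : Measure (ℝ × Space d × Space d)).condKernel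
      = (Γ : Measure (ℝ × Space d × Space d)) := by
  set tm : ProbabilityMeasure ℝ := ⟨timeMeasure T, inferInstance⟩ with htm
  have h1 := ProbabilityMeasure.tendsto_map_of_tendsto_of_continuous _ _ hΓ
    (f := Prod.fst) continuous_fst
  have h2 : ∀ i, (jointMeasure T (γs i)).map (f := Prod.fst) measurable_fst.aemeasurable
      = tm := fun i => by
    refine ProbabilityMeasure.toMeasure_injective ?_
    rw [ProbabilityMeasure.toMeasure_map, coe_jointMeasure]
    exact Measure.fst_compProd _ _
  simp only [h2] at h1
  have h3 : (Γ : Measure (ℝ × Space d × Space d)).fst = timeMeasure T := by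
    have := congrArg ProbabilityMeasure.toMeasure (tendsto_nhds_unique h1 tendsto_const_nhds)
    rwa [ProbabilityMeasure.toMeasure_map] at this
  conv_rhs => rw [← (Γ : Measure (ℝ × Space d × Space d)).disintegrate
    (Γ : Measure (ℝ × Space d × Space d)).condKernel, h3]

/-- The images under `(t, x, y) ↦ (t, y)` all equal `dt ⊗ m` up to normalization, hence so does that
of `Γ`. A.e. uniqueness of disintegrations concludes. -/
lemma condKernel_snd {m : Measure (Space d)} [IsProbabilityMeasure m]
    (hΓ : Tendsto (fun i => jointMeasure T (γs i)) l (𝓝 Γ))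
    (hs : ∀ i, ∀ᵐ t ∂timeMeasure T, (γs i t).snd = m) :
    ∀ᵐ t ∂timeMeasure T, ((Γ : Measure (ℝ × Space d × Space d)).condKernel t).snd = m := by
  set κ := (Γ : Measure (ℝ × Space d × Space d)).condKernel with hκ
  have hcont : Continuous (Prod.map id Prod.snd : ℝ × Space d × Space d → ℝ × Space d) := by
    fun_prop
  set tm : ProbabilityMeasure (ℝ × Space d) :=
    ⟨timeMeasure T ⊗ₘ Kernel.const ℝ m, inferInstance⟩ with htm
  have h1 := ProbabilityMeasure.tendsto_map_of_tendsto_of_continuous _ _ hΓ hcont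
  have h2 : ∀ i, (jointMeasure T (γs i)).map hcont.measurable.aemeasurable = tm := fun i => by
    refine ProbabilityMeasure.toMeasure_injective ?_
    rw [ProbabilityMeasure.toMeasure_map, coe_jointMeasure, ← Measure.compProd_map measurable_snd]
    refine Measure.compProd_congr ?_
    filter_upwards [hs i] with t ht
    rw [Kernel.map_apply _ measurable_snd, Kernel.const_apply]
    exact ht
  simp only [h2] at h1
  have h3 := congrArg ProbabilityMeasure.toMeasure (tendsto_nhds_unique h1 tendsto_const_nhds)
  rw [ProbabilityMeasure.toMeasure_map, ← timeMeasure_compProd_condKernel hΓ,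
    ← Measure.compProd_map measurable_snd] at h3
  have : IsMarkovKernel (κ.map Prod.snd) := Kernel.IsMarkovKernel.map _ measurable_snd
  filter_upwards [Kernel.ae_eq_of_compProd_eq h3] with t ht
  rw [Kernel.map_apply _ measurable_snd, Kernel.const_apply] at ht
  exact ht

/-- The images under `(t, x, y) ↦ (t, x)` are `dt ⊗ αs i t` up to normalization. Against an
`L`-Lipschitz function they differ from `dt ⊗ α t` by at most `L * uniformW2`, which tends to `0`.
-/
lemma condKernel_fst {αs : ι → ℝ → ProbabilityMeasure (Space d)}
    {α : ℝ → ProbabilityMeasure (Space d)}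
    (hΓ : Tendsto (fun i => jointMeasure T (γs i)) l (𝓝 Γ))
    (hu : Tendsto (fun i => uniformW2 T (αs i) α) l (𝓝 0)) (hc : W2Continuous T α)
    (hs : ∀ i, ∀ᵐ t ∂timeMeasure T, (γs i t).fst = αs i t) :
    ∀ᵐ t ∂timeMeasure T, ((Γ : Measure (ℝ × Space d × Space d)).condKernel t).fst = α t := by
  set κ := (Γ : Measure (ℝ × Space d × Space d)).condKernel with hκ
  obtain ⟨β, hβm, hβ⟩ := hc.exists_kernel hT.out
  have hcont : Continuous (Prod.map id Prod.fst : ℝ × Space d × Space d → ℝ × Space d) := by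
    fun_prop
  have : IsMarkovKernel (κ.map Prod.fst) := Kernel.IsMarkovKernel.map _ measurable_fst
  have key : Γ.map hcont.measurable.aemeasurable
      = (⟨timeMeasure T ⊗ₘ β, inferInstance⟩ : ProbabilityMeasure (ℝ × Space d)) := by
    refine ext_of_forall_lipschitz fun f L ⟨C, hC⟩ hL => ?_
    have h1 := ProbabilityMeasure.tendsto_map_of_tendsto_of_continuous _ _ hΓ hcont
    have hfint : ∀ (m : Measure (ℝ × Space d)) [IsProbabilityMeasure m], Integrable f m :=
      fun m _ => Integrable.of_bound hL.continuous.aestronglyMeasurable C (.of_forall hC)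
    have h2 := ProbabilityMeasure.tendsto_iff_forall_integral_tendsto.1 h1
      (BoundedContinuousFunction.ofNormedAddCommGroup f hL.continuous C hC)
    refine tendsto_nhds_unique h2 ?_
    simp only [BoundedContinuousFunction.coe_ofNormedAddCommGroup]
    rw [tendsto_iff_edist_tendsto_0]
    have hlim : Tendsto (fun i => (L : ℝ≥0∞) * uniformW2 T (αs i) α) l (𝓝 0) := by
      have := ENNReal.Tendsto.const_mul (a := (L : ℝ≥0∞)) hu (Or.inr ENNReal.coe_ne_top)
      rwa [mul_zero] at this
    refine tendsto_of_tendsto_of_tendsto_of_le_of_le tendsto_const_nhds hlim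
      (fun _ => zero_le) fun i => ?_
    have : IsMarkovKernel ((γs i).map Prod.fst) := Kernel.IsMarkovKernel.map _ measurable_fst
    have e1 : ((jointMeasure T (γs i)).map hcont.measurable.aemeasurable : Measure (ℝ × Space d))
        = timeMeasure T ⊗ₘ ((γs i).map Prod.fst) := by
      rw [ProbabilityMeasure.toMeasure_map, coe_jointMeasure, ← Measure.compProd_map measurable_fst]
    change edist (∫ q, f q ∂((jointMeasure T (γs i)).map hcont.measurable.aemeasurable :
      Measure (ℝ × Space d))) (∫ q, f q ∂(timeMeasure T ⊗ₘ β)) ≤ _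
    rw [e1, edist_eq_enorm_sub, Measure.integral_compProd (hfint _),
      Measure.integral_compProd (hfint _),
      ← integral_sub (integrable_integral_of_compProd (hfint _))
        (integrable_integral_of_compProd (hfint _))]
    refine (enorm_integral_le_lintegral_enorm _).trans ?_
    calc ∫⁻ t, ‖∫ x, f (t, x) ∂((γs i).map Prod.fst t) - ∫ x, f (t, x) ∂(β t)‖ₑ ∂timeMeasure T
        ≤ ∫⁻ _, L * uniformW2 T (αs i) α ∂timeMeasure T := by
          refine lintegral_mono_ae ?_
          filter_upwards [hs i, ae_timeMeasure_mem] with t ht htT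
          rw [Kernel.map_apply _ measurable_fst, hβ t htT]
          rw [Measure.fst] at ht
          rw [ht]
          have hLt : LipschitzWith L fun x => f (t, x) := by
            have := hL.comp (LipschitzWith.prodMk_left t)
            rwa [mul_one] at this
          refine (enorm_integral_sub_le_W2 hLt ⟨C, fun x => hC _⟩).trans ?_
          gcongr
          exact W2_le_uniformW2 _ _ htT
      _ = _ := by simp
  have h3 := congrArg ProbabilityMeasure.toMeasure key
  rw [ProbabilityMeasure.toMeasure_map, ← timeMeasure_compProd_condKernel hΓ,
    ← Measure.compProd_map measurable_fst] at h3
  filter_upwards [Kernel.ae_eq_of_compProd_eq h3, ae_timeMeasure_mem] with t ht htT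
  rw [Kernel.map_apply _ measurable_fst, hβ t htT] at ht
  exact ht

end Limit

lemma measurable_quadCost (γ : Kernel ℝ (Space d × Space d)) :
    Measurable fun t => quadCost (γ t) :=
  (Measure.measurable_lintegral (by fun_prop)).comp γ.measurable

/-- Rewrites the total cost as the integral of a continuous function, so that it passes to weak
limits on the compact carrier. -/
lemma lintegral_quadCost {T R r : ℝ} [Fact (0 < T)] (γ : Kernel ℝ (Space d × Space d))
    [IsMarkovKernel γ] (h : (timeMeasure T ⊗ₘ γ) (carrier d T R r)ᶜ = 0) :
    ∫⁻ t, quadCost (γ t) ∂timeMeasure T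
      = ENNReal.ofReal (∫ q, ‖q.2.1 - q.2.2‖ ^ 2 ∂(timeMeasure T ⊗ₘ γ)) := by
  rw [ofReal_integral_eq_lintegral_ofReal
    (integrable_of_isCompact (isCompact_carrier T R r) h (by fun_prop))
    (.of_forall fun q => by positivity)]
  rw [Measure.lintegral_compProd (by fun_prop)]
  refine lintegral_congr fun t => lintegral_congr fun p => ?_
  rw [ENNReal.ofReal_pow (norm_nonneg _), ofReal_norm]

/-- Stability: if weak curves whose plans are nearly optimal converge uniformly in Wasserstein
distance, and their plans converge weakly, then the limit is a weak solution with the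
disintegrated limit plan. -/
theorem isSGSolutionWith_of_tendsto {ι : Type*} {l : Filter ι} [l.NeBot] {T R₀ : ℝ}
    [hT : Fact (0 < T)] {A : Space d →L[ℝ] Space d}
    {α₀ μ₀ : ProbabilityMeasure (Space d)} (hμ₀ : SupportedInBall (μ₀ : Measure (Space d)) R₀)
    {αs : ι → ℝ → ProbabilityMeasure (Space d)} {γs : ι → Kernel ℝ (Space d × Space d)}
    [∀ i, IsMarkovKernel (γs i)] {α : ℝ → ProbabilityMeasure (Space d)}
    (hc : ∀ i, IsWeakCurve T R₀ A (α₀ : Measure (Space d)) (αs i) (γs i))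
    (hp : ∀ i, ∀ᵐ t ∂timeMeasure T, γs i t ∈ plans (αs i t : Measure (Space d)) μ₀)
    (ho : ∀ δ : NNReal, 0 < δ → ∀ᶠ i in l, ∀ᵐ t ∂timeMeasure T,
      quadCost (γs i t) ≤ (W2 (αs i t : Measure (Space d)) μ₀ + δ) ^ 2 + δ)
    (hu : Tendsto (fun i => uniformW2 T (αs i) α) l (𝓝 0))
    {Γ : ProbabilityMeasure (ℝ × Space d × Space d)}
    (hΓ : Tendsto (fun i => jointMeasure T (γs i)) l (𝓝 Γ)) :
    IsSGSolutionWith T R₀ A (α₀ : Measure (Space d)) μ₀ α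
      (Γ : Measure (ℝ × Space d × Space d)).condKernel := by
  set R := 2 * R₀ * Real.exp (‖A‖ * T) with hR
  set κ := (Γ : Measure (ℝ × Space d × Space d)).condKernel with hκ
  have h0T : (0 : ℝ) ∈ Icc 0 T := ⟨le_rfl, hT.out.le⟩
  have hTT : T ∈ Icc 0 T := ⟨hT.out.le, le_rfl⟩
  have hcont : W2Continuous T α := W2Continuous.of_uniformW2 hu fun i => (hc i).continuous
  have hweak : ∀ t ∈ Icc 0 T, Tendsto (fun i => αs i t) l (𝓝 (α t)) := fun t ht =>
    tendsto_of_tendsto_W2 (tendsto_W2_of_uniformW2 hu ht)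
  have hsupp : ∀ t ∈ Icc 0 T, SupportedInBall (α t : Measure (Space d)) R := fun t ht =>
    measure_compl_eq_zero_of_tendsto (hweak t ht) Metric.isClosed_closedBall
      (.of_forall fun i => (hc i).support t ht)
  have hinit : α 0 = α₀ := by
    have h1 : ∀ i, αs i 0 = α₀ := fun i =>
      ProbabilityMeasure.toMeasure_injective (hc i).initial
    have h2 := hweak 0 h0T
    simp only [h1] at h2
    exact tendsto_nhds_unique tendsto_const_nhds h2 |>.symm
  have hκplan : ∀ᵐ t ∂timeMeasure T, κ t ∈ plans (α t : Measure (Space d)) μ₀ := by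
    filter_upwards [condKernel_fst hΓ hu hcont fun i => (hp i).mono fun t ht => ht.1,
      condKernel_snd hΓ fun i => (hp i).mono fun t ht => ht.2] with t h1 h2
    exact ⟨h1, h2⟩
  have hΓκ : timeMeasure T ⊗ₘ κ = (Γ : Measure (ℝ × Space d × Space d)) :=
    timeMeasure_compProd_condKernel hΓ
  have hKi : ∀ i, (jointMeasure T (γs i) : Measure (ℝ × Space d × Space d))
      (carrier d T R R₀)ᶜ = 0 := fun i =>
    measure_compl_carrier (hc i).support hμ₀ (hp i)
  have hK : (timeMeasure T ⊗ₘ κ) (carrier d T R R₀)ᶜ = 0 :=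
    measure_compl_carrier hsupp hμ₀ hκplan
  have hK' := hK
  rw [hΓκ] at hK'
  refine ⟨⟨hcont, by rw [hinit], hsupp, ?_⟩, ?_⟩
  · rw [weakEquation_iff hsupp hμ₀ hκplan]
    intro f hf
    have hfT : Continuous fun x => f (T, x) := hf.continuous.comp (by fun_prop)
    have l1 := (tendsto_integral_of_isCompact hΓ (isCompact_carrier T R R₀) hKi hK'
      (continuous_transportDeriv (A := A) hf)).const_mul T
    have l2 := (tendsto_integral_of_isCompact (hweak T hTT)
      (isCompact_closedBall (0 : Space d) R) (fun i => (hc i).support T hTT)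
      (hsupp T hTT) hfT).sub_const (∫ x, f (0, x) ∂(α₀ : Measure (Space d)))
    have l3 : ∀ i, T * ∫ q, transportDeriv A f q
          ∂(jointMeasure T (γs i) : Measure (ℝ × Space d × Space d))
        = (∫ x, f (T, x) ∂(αs i T : Measure (Space d))) - ∫ x, f (0, x) ∂α₀ := fun i =>
      (weakEquation_iff (hc i).support hμ₀ (hp i)).1 (hc i).equation f hf
    simp only [l3] at l1
    rw [hΓκ]
    exact tendsto_nhds_unique l1 l2
  · rw [← ae_timeMeasure_iff]
    set M : NNReal := Real.toNNReal (R + R₀) with hM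
    have hWM : ∀ t ∈ Icc 0 T, W2 (α t : Measure (Space d)) μ₀ ≤ M := fun t ht =>
      W2_le_of_supportedInBall (hsupp t ht) hμ₀
    have hle : (fun t => W2sq (α t : Measure (Space d)) μ₀) ≤ᵐ[timeMeasure T]
        fun t => quadCost (κ t) := by
      filter_upwards [hκplan] with t ht
      exact W2sq_le ht
    have hfin : ∫⁻ t, W2sq (α t : Measure (Space d)) μ₀ ∂timeMeasure T ≠ ∞ := by
      refine ne_top_of_le_ne_top (b := (M : ℝ≥0∞) ^ 2) (by finiteness) ?_
      calc ∫⁻ t, W2sq (α t : Measure (Space d)) μ₀ ∂timeMeasure T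
          ≤ ∫⁻ _, (M : ℝ≥0∞) ^ 2 ∂timeMeasure T := by
            refine lintegral_mono_ae ?_
            filter_upwards [ae_timeMeasure_mem] with t ht
            rw [W2sq_eq_sq]
            gcongr
            exact hWM t ht
        _ = _ := by simp
    -- The error is that of `(W + 2δ) ^ 2 + δ` with `W ≤ M`. One `δ` inside the square comes from
    -- replacing `αs i` by `α`, the other from near optimality.
    have hcost : ∀ δ : NNReal, 0 < δ → ∫⁻ t, quadCost (κ t) ∂timeMeasure T
        ≤ ∫⁻ t, W2sq (α t : Measure (Space d)) μ₀ ∂timeMeasure T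
          + (4 * M * δ + 4 * δ ^ 2 + δ) := by
      intro δ hδ
      have l1 := ENNReal.tendsto_ofReal (tendsto_integral_of_isCompact hΓ
        (isCompact_carrier T R R₀) hKi hK'
        (g := fun q => ‖q.2.1 - q.2.2‖ ^ 2) (by fun_prop))
      rw [lintegral_quadCost κ hK, hΓκ]
      refine le_of_tendsto l1 ?_
      filter_upwards [ho δ hδ, ENNReal.tendsto_nhds_zero.1 hu δ (by exact_mod_cast hδ)]
        with i hi hui
      rw [coe_jointMeasure, ← lintegral_quadCost (γs i) (hKi i)]
      calc ∫⁻ t, quadCost (γs i t) ∂timeMeasure T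
          ≤ ∫⁻ t, (W2sq (α t : Measure (Space d)) μ₀ + (4 * M * δ + 4 * δ ^ 2 + δ))
              ∂timeMeasure T := by
            refine lintegral_mono_ae ?_
            filter_upwards [hi, ae_timeMeasure_mem] with t ht htT
            have hW : W2 (αs i t : Measure (Space d)) μ₀
                ≤ W2 (α t : Measure (Space d)) μ₀ + δ := by
              rw [add_comm]
              exact (W2_triangle _ (α t : Measure (Space d)) _).trans
                (add_le_add_left ((W2_le_uniformW2 _ _ htT).trans hui) _)
            calc quadCost (γs i t) ≤ (W2 (αs i t : Measure (Space d)) μ₀ + δ) ^ 2 + δ := ht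
              _ ≤ (W2 (α t : Measure (Space d)) μ₀ + δ + δ) ^ 2 + δ := by gcongr
              _ = W2sq (α t : Measure (Space d)) μ₀
                  + (4 * W2 (α t : Measure (Space d)) μ₀ * δ + 4 * δ ^ 2 + δ) := by
                  rw [W2sq_eq_sq]; ring
              _ ≤ _ := by gcongr; exact hWM t htT
        _ = _ := by
            rw [lintegral_add_right _ measurable_const, lintegral_const, measure_univ, mul_one]
    have hcost' : ∫⁻ t, quadCost (κ t) ∂timeMeasure T
        ≤ ∫⁻ t, W2sq (α t : Measure (Space d)) μ₀ ∂timeMeasure T := by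
      refine ENNReal.le_of_forall_pos_le_add fun η hη _ => ?_
      -- With `δ ≤ 1`, `δ ^ 2 ≤ δ`, so the whole error is at most `(4 * M + 5) * δ ≤ η`.
      set δ : NNReal := min 1 (η / (4 * M + 5)) with hδ
      have hδ0 : 0 < δ := by positivity
      have hδ1 : δ ≤ 1 := min_le_left _ _
      have hδη : (4 * M + 5) * δ ≤ η := by
        calc (4 * M + 5) * δ ≤ (4 * M + 5) * (η / (4 * M + 5)) := by
              gcongr
              exact min_le_right _ _
          _ = η := mul_div_cancel₀ η (by positivity)
      refine (hcost δ hδ0).trans ?_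
      gcongr
      have : 4 * M * δ + 4 * δ ^ 2 + δ ≤ η := by
        refine le_trans ?_ hδη
        have : δ ^ 2 ≤ δ := by
          rw [sq]
          exact mul_le_of_le_one_left' hδ1
        calc 4 * M * δ + 4 * δ ^ 2 + δ ≤ 4 * M * δ + 4 * δ + δ := by gcongr
          _ = (4 * M + 5) * δ := by ring
      exact_mod_cast this
    -- Pointwise `W2sq ≤ quadCost`, together with the reverse inequality of finite integrals, forces
    -- equality for a.e. `t`.
    filter_upwards [hκplan, ae_eq_of_ae_le_of_lintegral_le hle hfin
      (measurable_quadCost κ).aemeasurable hcost'] with t h1 h2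
    exact ⟨h1, h2.symm⟩

/-! ### Convergence of entropic solutions -/

/-- Prokhorov's theorem, with the same compact set at every level of tightness. -/
lemma isCompact_setOf_probabilityMeasure_compl_eq_zero {X : Type*} [MetricSpace X]
    [MeasurableSpace X] [BorelSpace X] {K : Set X} (hK : IsCompact K) :
    IsCompact {m : ProbabilityMeasure X | (m : Measure X) Kᶜ = 0} := by
  have h := isCompact_setOfPred_probabilityMeasure_mass_eq_compl_isCompact_le (E := X)
    (u := fun _ => 0) (K := fun _ => K) tendsto_const_nhds (fun _ => hK) (Or.inl inferInstance)
  convert h using 2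
  ext m
  simp

lemma WeakEquation.congr {T : ℝ} [hT : Fact (0 < T)] {A : Space d →L[ℝ] Space d}
    {α₀ : Measure (Space d)} {α : ℝ → ProbabilityMeasure (Space d)}
    {γ γ' : Kernel ℝ (Space d × Space d)} (h : WeakEquation T A α₀ α γ)
    (hγ : ∀ᵐ t ∂timeMeasure T, γ' t = γ t) : WeakEquation T A α₀ α γ' := by
  intro f hf
  rw [← h f hf]
  congr 1
  rw [intervalIntegral_eq_timeMeasure hT.out, intervalIntegral_eq_timeMeasure hT.out]
  congr 1
  refine integral_congr_ae ?_
  filter_upwards [hγ] with t ht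
  rw [ht]

lemma integral_jointMeasure {T : ℝ} [hT : Fact (0 < T)] {γ γ' : Kernel ℝ (Space d × Space d)}
    [IsMarkovKernel γ'] (hγ : ∀ᵐ t ∂timeMeasure T, γ' t = γ t)
    (g : BoundedContinuousFunction (ℝ × Space d × Space d) ℝ) :
    ∫ t in (0 : ℝ)..T, ∫ p, g (t, p) ∂(γ t)
      = T * ∫ q, g q ∂(jointMeasure T γ' : Measure (ℝ × Space d × Space d)) := by
  rw [coe_jointMeasure, intervalIntegral_eq_timeMeasure hT.out,
    Measure.integral_compProd (g.integrable _)]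
  congr 1
  refine integral_congr_ae ?_
  filter_upwards [hγ] with t ht
  rw [ht]

/-- Compactness provides a convergent subsequence of the joint measures, and the stability theorem
identifies its limit. Near optimality holds because, for fixed `δ`, the entropy bound `K` is
independent of `n` and `t`, so `ε n * K` is eventually below `δ`. -/
theorem exists_subseq_isSGSolutionWith {T R₀ : ℝ} [hT : Fact (0 < T)]
    {A : Space d →L[ℝ] Space d} {α₀ μ₀ : ProbabilityMeasure (Space d)}
    (hμ₀ : SupportedInBall (μ₀ : Measure (Space d)) R₀) {ε : ℕ → ℝ}
    {αs : ℕ → ℝ → ProbabilityMeasure (Space d)} {γs : ℕ → Kernel ℝ (Space d × Space d)}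
    {α : ℝ → ProbabilityMeasure (Space d)} (hε : Tendsto ε atTop (𝓝 0))
    (hs : ∀ n, IsEntropicSolutionWith (ε n) T R₀ A (α₀ : Measure (Space d)) μ₀ (αs n) (γs n))
    (hu : Tendsto (fun n => uniformW2 T (αs n) α) atTop (𝓝 0)) :
    ∃ (φ : ℕ → ℕ) (γ : Kernel ℝ (Space d × Space d)), StrictMono φ ∧
      PlansConverge T (fun n => γs (φ n)) γ ∧
      IsSGSolutionWith T R₀ A (α₀ : Measure (Space d)) μ₀ α γ := by
  have hplan : ∀ n, ∀ᵐ t ∂timeMeasure T,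
      IsEntropicPlan (ε n) (αs n t : Measure (Space d)) μ₀ (γs n t) := fun n =>
    ae_timeMeasure_iff.2 (hs n).2
  choose γ' hγm hγ' using fun n => exists_markov_ae_eq (T := T) (γs n)
    ((hplan n).mono fun t ht => isProbabilityMeasure_of_mem_plans ht.1)
  have hplan' : ∀ n, ∀ᵐ t ∂timeMeasure T,
      IsEntropicPlan (ε n) (αs n t : Measure (Space d)) μ₀ (γ' n t) := fun n => by
    filter_upwards [hplan n, hγ' n] with t h1 h2
    rwa [h2]
  have hc : ∀ n, IsWeakCurve T R₀ A (α₀ : Measure (Space d)) (αs n) (γ' n) := fun n =>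
    { (hs n).1 with equation := (hs n).1.equation.congr (hγ' n) }
  obtain ⟨Γ, -, φ, hφ, hlim⟩ := (isCompact_setOf_probabilityMeasure_compl_eq_zero
    (isCompact_carrier (d := d) T (2 * R₀ * Real.exp (‖A‖ * T)) R₀)).isSeqCompact
    (x := fun n => jointMeasure T (γ' n)) fun n =>
      measure_compl_carrier (hc n).support hμ₀ ((hplan' n).mono fun t ht => ht.1)
  have hsol := isSGSolutionWith_of_tendsto (l := atTop) (αs := fun n => αs (φ n))
    (γs := fun n => γ' (φ n)) (α := α) hμ₀ (fun n => hc (φ n))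
    (fun n => (hplan' (φ n)).mono fun t ht => ht.1) (fun δ hδ => ?_)
    (hu.comp hφ.tendsto_atTop) hlim
  · refine ⟨φ, _, hφ, fun g => ?_, hsol⟩
    have h1 := (ProbabilityMeasure.tendsto_iff_forall_integral_tendsto.1 hlim g).const_mul T
    have h2 : ∀ n, ∫ t in (0 : ℝ)..T, ∫ p, g (t, p) ∂(γs (φ n) t)
        = T * ∫ q, g q ∂(jointMeasure T (γ' (φ n)) : Measure (ℝ × Space d × Space d)) := fun n =>
      integral_jointMeasure (hγ' (φ n)) g
    simp only [h2]
    rw [integral_jointMeasure (.of_forall fun _ => rfl) g, coe_jointMeasure,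
      timeMeasure_compProd_condKernel hlim]
    exact h1
  · obtain ⟨K, hK⟩ := exists_quadCost_le_of_isEntropicPlan (μ₀ : Measure (Space d)) hμ₀
      (δ := (δ : ℝ)) (by exact_mod_cast hδ)
    have h1 : Tendsto (fun n => ENNReal.ofReal (ε (φ n)) * (K : ℝ≥0∞)) atTop (𝓝 0) := by
      have := ENNReal.Tendsto.mul_const (b := (K : ℝ≥0∞))
        (ENNReal.tendsto_ofReal (hε.comp hφ.tendsto_atTop)) (Or.inr ENNReal.coe_ne_top)
      simpa using this
    filter_upwards [ENNReal.tendsto_nhds_zero.1 h1 δ (by exact_mod_cast hδ)] with n hn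
    filter_upwards [hplan' (φ n)] with t ht
    have := hK _ _ _ ht
    rw [ENNReal.ofReal_coe_nnreal] at this
    exact this.trans (by gcongr)

/-! ### The linear flow with frozen target point -/

/-- The propagator `exp (s A)`. -/
noncomputable def propagator (A : Space d →L[ℝ] Space d) (s : ℝ) : Space d →L[ℝ] Space d :=
  NormedSpace.exp (s • A)

lemma propagator_zero (A : Space d →L[ℝ] Space d) : propagator A 0 = 1 := by
  rw [propagator, zero_smul ℝ A, NormedSpace.exp_zero]

lemma hasDerivAt_propagator (A : Space d →L[ℝ] Space d) (s : ℝ) :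
    HasDerivAt (propagator A) (A * propagator A s) s :=
  hasDerivAt_exp_smul_const' A s

lemma continuous_propagator (A : Space d →L[ℝ] Space d) : Continuous (propagator A) :=
  continuous_iff_continuousAt.2 fun s => (hasDerivAt_propagator A s).continuousAt

/-- Grönwall for `P - 1`, which starts at `0` and has derivative `A (P - 1) + A`. The sharp `- 1` on
the right is what yields the exact radius in `norm_flow_fst_add_le`. -/
lemma norm_propagator_sub_one_le (A : Space d →L[ℝ] Space d) {s : ℝ} (hs : 0 ≤ s) :
    ‖propagator A s - 1‖ ≤ Real.exp (‖A‖ * s) - 1 := by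
  have h := norm_le_gronwallBound_of_norm_deriv_right_le (f := fun s => propagator A s - 1)
    (f' := fun s => A * propagator A s) (δ := 0) (K := ‖A‖) (ε := ‖A‖) (a := 0) (b := s)
    ((continuous_propagator A).sub continuous_const).continuousOn
    (fun x _ => ((hasDerivAt_propagator A x).sub_const 1).hasDerivWithinAt)
    (by simp [propagator_zero]) (fun x _ => ?_) s ⟨hs, le_rfl⟩
  · refine h.trans_eq ?_
    rw [gronwallBound]
    split_ifs with h0
    · simp [h0]
    · rw [div_self h0]
      simp
  · calc ‖A * propagator A x‖ = ‖A * (propagator A x - 1) + A‖ := by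
          rw [mul_sub, mul_one, sub_add_cancel]
      _ ≤ ‖A‖ * ‖propagator A x - 1‖ + ‖A‖ :=
          (norm_add_le _ _).trans (by gcongr; exact norm_mul_le _ _)

lemma norm_propagator_le (A : Space d →L[ℝ] Space d) {s : ℝ} (hs : 0 ≤ s) :
    ‖propagator A s‖ ≤ Real.exp (‖A‖ * s) := by
  have h1 := norm_propagator_sub_one_le A hs
  -- Only an inequality: in dimension `0` the identity has norm `0`.
  have h2 : ‖(1 : Space d →L[ℝ] Space d)‖ ≤ 1 := ContinuousLinearMap.norm_id_le
  have h3 := norm_add_le (propagator A s - 1) 1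
  rw [sub_add_cancel] at h3
  linarith

lemma norm_propagator_sub_le (A : Space d →L[ℝ] Space d) {T s s' : ℝ} (hs : s ∈ Icc 0 T)
    (hs' : s' ∈ Icc 0 T) :
    ‖propagator A s - propagator A s'‖ ≤ ‖A‖ * Real.exp (‖A‖ * T) * |s - s'| := by
  refine Convex.norm_image_sub_le_of_norm_hasDerivWithin_le
    (fun x _ => (hasDerivAt_propagator A x).hasDerivWithinAt) (fun x hx => ?_)
    (convex_Icc 0 T) hs' hs
  refine (norm_mul_le _ _).trans ?_
  gcongr
  refine (norm_propagator_le A hx.1).trans ?_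
  gcongr
  exact hx.2

/-- The flow at time `s` of `x' = A (x - y)`, `y' = 0`. -/
noncomputable def flow (A : Space d →L[ℝ] Space d) (s : ℝ) (p : Space d × Space d) :
    Space d × Space d :=
  (p.2 + propagator A s (p.1 - p.2), p.2)

lemma flow_zero (A : Space d →L[ℝ] Space d) : flow A 0 = id := by
  ext p : 1
  simp [flow, propagator_zero]

lemma continuous_flow_uncurry (A : Space d →L[ℝ] Space d) :
    Continuous fun q : ℝ × Space d × Space d => flow A q.1 q.2 := by
  have : Continuous fun q : ℝ × Space d × Space d => propagator A q.1 (q.2.1 - q.2.2) :=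
    ((continuous_propagator A).comp continuous_fst).clm_apply (by fun_prop)
  unfold flow
  fun_prop

lemma continuous_flow (A : Space d →L[ℝ] Space d) (s : ℝ) : Continuous (flow A s) :=
  (continuous_flow_uncurry A).comp (by fun_prop : Continuous fun p => (s, p))

lemma measurable_flow (A : Space d →L[ℝ] Space d) (s : ℝ) : Measurable (flow A s) :=
  (continuous_flow A s).measurable

/-- Write the endpoint as `P x - (P - 1) y`: the bound `exp - 1` on the second term leaves room for
the added `r`. Hence `‖x‖ + R₀`, initially at most `2 * R₀`, grows by the factor `exp (‖A‖ h)` per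
step, which explains the radius `2 * R₀ * exp (‖A‖ T)`. -/
lemma norm_flow_fst_add_le (A : Space d →L[ℝ] Space d) {s r : ℝ} (hs : 0 ≤ s)
    {p : Space d × Space d} (hp : ‖p.2‖ ≤ r) :
    ‖(flow A s p).1‖ + r ≤ Real.exp (‖A‖ * s) * (‖p.1‖ + r) := by
  have e1 : (flow A s p).1 = propagator A s p.1 - (propagator A s - 1) p.2 := by
    simp [flow, map_sub]
    abel
  have h1 : ‖propagator A s p.1‖ ≤ Real.exp (‖A‖ * s) * ‖p.1‖ :=
    (propagator A s).le_of_opNorm_le (norm_propagator_le A hs) _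
  have h2 : ‖(propagator A s - 1) p.2‖ ≤ (Real.exp (‖A‖ * s) - 1) * ‖p.2‖ :=
    (propagator A s - 1).le_of_opNorm_le (norm_propagator_sub_one_le A hs) _
  have h3 : (Real.exp (‖A‖ * s) - 1) * ‖p.2‖ ≤ (Real.exp (‖A‖ * s) - 1) * r := by
    refine mul_le_mul_of_nonneg_left hp ?_
    have := Real.one_le_exp (show 0 ≤ ‖A‖ * s by positivity)
    linarith
  have h4 := norm_sub_le (propagator A s p.1) ((propagator A s - 1) p.2)
  rw [e1]
  nlinarith

lemma norm_flow_sub_le (A : Space d →L[ℝ] Space d) {s : ℝ} (hs : 0 ≤ s) (p : Space d × Space d) :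
    ‖(flow A s p).1 - (flow A s p).2‖ ≤ Real.exp (‖A‖ * s) * ‖p.1 - p.2‖ := by
  have e1 : (flow A s p).1 - (flow A s p).2 = propagator A s (p.1 - p.2) := by
    simp [flow]
  rw [e1]
  exact (propagator A s).le_of_opNorm_le (norm_propagator_le A hs) _

lemma norm_flow_fst_sub_le (A : Space d →L[ℝ] Space d) {T s s' : ℝ} (hs : s ∈ Icc 0 T)
    (hs' : s' ∈ Icc 0 T) (p : Space d × Space d) :
    ‖(flow A s p).1 - (flow A s' p).1‖
      ≤ ‖A‖ * Real.exp (‖A‖ * T) * |s - s'| * ‖p.1 - p.2‖ := by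
  have e1 : (flow A s p).1 - (flow A s' p).1
      = (propagator A s - propagator A s') (p.1 - p.2) := by
    simp [flow]
  rw [e1]
  exact (propagator A s - propagator A s').le_of_opNorm_le (norm_propagator_sub_le A hs hs') _

lemma hasDerivAt_comp_flow (A : Space d →L[ℝ] Space d) {f : ℝ × Space d → ℝ}
    (hf : ContDiff ℝ 1 f) (c : ℝ) (p : Space d × Space d) (t : ℝ) :
    HasDerivAt (fun t => f (t, (flow A (t - c) p).1))
      (transportDeriv A f (t, flow A (t - c) p)) t := by
  have h1 : HasFDerivAt f (fderiv ℝ f (t, (flow A (t - c) p).1)) (t, (flow A (t - c) p).1) :=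
    (hf.differentiable one_ne_zero _).hasFDerivAt
  have h2 : HasDerivAt (fun t => (flow A (t - c) p).1)
      (A ((flow A (t - c) p).1 - (flow A (t - c) p).2)) t := by
    have h3 := ((hasDerivAt_propagator A (t - c)).comp_sub_const t c).clm_apply
      (hasDerivAt_const t (p.1 - p.2))
    simpa [flow] using! h3.const_add p.2
  exact h1.comp_hasDerivAt t ((hasDerivAt_id t).prodMk h2)

/-- Exchange the integrals and apply the fundamental theorem of calculus along each trajectory. -/
lemma intervalIntegral_transportDeriv_flow (A : Space d →L[ℝ] Space d) {f : ℝ × Space d → ℝ}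
    (hf : ContDiff ℝ 1 f) {m : Measure (Space d × Space d)} [IsProbabilityMeasure m]
    {K : Set (Space d × Space d)} (hK : IsCompact K) (hm : m Kᶜ = 0) (c e : ℝ) :
    ∫ t in c..e, ∫ p, transportDeriv A f (t, flow A (t - c) p) ∂m
      = ∫ p, f (e, (flow A (e - c) p).1) ∂m - ∫ p, f (c, p.1) ∂m := by
  have hcont : Continuous fun q : ℝ × Space d × Space d =>
      transportDeriv A f (q.1, flow A (q.1 - c) q.2) :=
    (continuous_transportDeriv hf).comp (continuous_fst.prodMk
      ((continuous_flow_uncurry A).comp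
        (by fun_prop : Continuous fun q : ℝ × Space d × Space d => (q.1 - c, q.2))))
  have hint : Integrable (Function.uncurry fun t p => transportDeriv A f (t, flow A (t - c) p))
      ((volume.restrict (uIoc c e)).prod m) := by
    have hae : ∀ᵐ p ∂m, p ∈ K := hm
    rw [← Measure.restrict_eq_self_of_ae_mem hae, Measure.prod_restrict]
    exact (hcont.continuousOn.integrableOn_compact (isCompact_uIcc.prod hK)).mono_set
      (prod_mono uIoc_subset_uIcc le_rfl)
  have i1 : Integrable (fun p => f (e, (flow A (e - c) p).1)) m :=
    integrable_of_isCompact hK hm (hf.continuous.comp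
      (continuous_const.prodMk (continuous_fst.comp (continuous_flow A _))))
  have i2 : Integrable (fun p => f (c, p.1)) m :=
    integrable_of_isCompact hK hm (hf.continuous.comp (by fun_prop))
  rw [intervalIntegral_integral_swap hint, ← integral_sub i1 i2]
  refine integral_congr_ae (.of_forall fun p => ?_)
  simp only
  rw [intervalIntegral.integral_eq_sub_of_hasDerivAt
    (fun t _ => hasDerivAt_comp_flow A hf c p t)]
  · simp [flow_zero]
  · exact (hcont.comp (by fun_prop : Continuous fun t : ℝ => (t, p))).intervalIntegrable _ _

/-! ### A time-stepping scheme with nearly optimal plans -/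

/-- A sequence of nearly optimal plans, the first marginal of each being transported by the flow
of the previous one during a time `h`. -/
structure IsScheme (A : Space d →L[ℝ] Space d) (h : ℝ) (e : ℝ≥0∞) (α₀ μ₀ : Measure (Space d))
    (G : ℕ → ProbabilityMeasure (Space d × Space d)) : Prop where
  init : (G 0 : Measure (Space d × Space d)).fst = α₀
  snd : ∀ k, (G k : Measure (Space d × Space d)).snd = μ₀
  step : ∀ k, (G (k + 1) : Measure (Space d × Space d)).fst
    = (G k : Measure (Space d × Space d)).map fun p => (flow A h p).1
  opt : ∀ k, eLpNorm (fun p : Space d × Space d => p.1 - p.2) 2 (G k)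
    ≤ W2 (G k : Measure (Space d × Space d)).fst μ₀ + e

/-- Recursion on the first marginal. If `W2` is infinite the near-optimality bound is vacuous and
the product plan serves. -/
lemma exists_isScheme (A : Space d →L[ℝ] Space d) (h : ℝ) {e : ℝ≥0∞} (he : e ≠ 0)
    (α₀ μ₀ : ProbabilityMeasure (Space d)) :
    ∃ G, IsScheme A h e (α₀ : Measure (Space d)) μ₀ G := by
  have hP : ∀ ν : ProbabilityMeasure (Space d), ∃ P : ProbabilityMeasure (Space d × Space d),
      (P : Measure (Space d × Space d)) ∈ plans (ν : Measure (Space d)) μ₀ ∧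
      eLpNorm (fun p : Space d × Space d => p.1 - p.2) 2 (P : Measure (Space d × Space d))
        ≤ W2 (ν : Measure (Space d)) μ₀ + e := by
    intro ν
    rcases eq_or_ne (W2 (ν : Measure (Space d)) μ₀) ∞ with htop | htop
    · exact ⟨⟨_, isProbabilityMeasure_of_mem_plans
        (prod_mem_plans (ν : Measure (Space d)) (μ₀ : Measure (Space d)))⟩,
        prod_mem_plans _ _, by simp [htop]⟩
    · obtain ⟨γ, hγ, hlt⟩ := exists_plan_eLpNorm_lt (ENNReal.lt_add_right htop he)
      exact ⟨⟨γ, isProbabilityMeasure_of_mem_plans hγ⟩, hγ, hlt.le⟩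
  choose P hP1 hP2 using hP
  have hm : Measurable fun p => (flow A h p).1 := measurable_fst.comp (measurable_flow A h)
  let ν : ℕ → ProbabilityMeasure (Space d) := fun k =>
    Nat.rec α₀ (fun _ ν => (P ν).map hm.aemeasurable) k
  have hν : ∀ k, ν (k + 1) = (P (ν k)).map hm.aemeasurable := fun _ => rfl
  refine ⟨fun k => P (ν k), (hP1 _).1, fun k => (hP1 _).2, fun k => ?_, fun k => ?_⟩
  · rw [(hP1 _).1, hν, ProbabilityMeasure.toMeasure_map]
  · rw [(hP1 _).1]
    exact hP2 _

/-- The family of plans interpolating a scheme along the flow. -/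
noncomputable def schemeKernel (A : Space d →L[ℝ] Space d) (h : ℝ)
    (G : ℕ → ProbabilityMeasure (Space d × Space d)) : Kernel ℝ (Space d × Space d) :=
  (Kernel.id ×ₖ (Kernel.ofFunOfCountable fun k => (G k : Measure (Space d × Space d))).comap
    (fun t : ℝ => ⌊t / h⌋₊) (by fun_prop)).map
      fun q => flow A (q.1 - ⌊q.1 / h⌋₊ * h) q.2

lemma measurable_flow_floor (A : Space d →L[ℝ] Space d) (h : ℝ) :
    Measurable fun q : ℝ × Space d × Space d => flow A (q.1 - ⌊q.1 / h⌋₊ * h) q.2 :=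
  (continuous_flow_uncurry A).measurable.comp (by fun_prop :
    Measurable fun q : ℝ × Space d × Space d => ((q.1 - ⌊q.1 / h⌋₊ * h, q.2) : ℝ × _))

instance isMarkovKernel_ofFunOfCountable
    (G : ℕ → ProbabilityMeasure (Space d × Space d)) :
    IsMarkovKernel (Kernel.ofFunOfCountable fun k => (G k : Measure (Space d × Space d))) :=
  ⟨fun k => inferInstanceAs (IsProbabilityMeasure (G k : Measure (Space d × Space d)))⟩

instance isMarkovKernel_schemeKernel (A : Space d →L[ℝ] Space d) (h : ℝ)
    (G : ℕ → ProbabilityMeasure (Space d × Space d)) : IsMarkovKernel (schemeKernel A h G) :=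
  Kernel.IsMarkovKernel.map _ (measurable_flow_floor A h)

lemma schemeKernel_apply (A : Space d →L[ℝ] Space d) (h : ℝ)
    (G : ℕ → ProbabilityMeasure (Space d × Space d)) (t : ℝ) :
    schemeKernel A h G t
      = (G ⌊t / h⌋₊ : Measure (Space d × Space d)).map (flow A (t - ⌊t / h⌋₊ * h)) := by
  have hm := measurable_flow_floor (d := d) A h
  rw [schemeKernel, Kernel.map_apply _ hm, Kernel.prod_apply, Kernel.id_apply, Kernel.comap_apply,
    Measure.dirac_prod, Measure.map_map hm (by fun_prop)]
  rfl

/-- The curve of first marginals of the interpolated plans. -/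
noncomputable def schemeCurve (A : Space d →L[ℝ] Space d) (h : ℝ)
    (G : ℕ → ProbabilityMeasure (Space d × Space d)) (t : ℝ) : ProbabilityMeasure (Space d) :=
  ⟨(schemeKernel A h G t).fst, inferInstance⟩

lemma coe_schemeCurve (A : Space d →L[ℝ] Space d) (h : ℝ)
    (G : ℕ → ProbabilityMeasure (Space d × Space d)) (t : ℝ) :
    (schemeCurve A h G t : Measure (Space d)) = (schemeKernel A h G t).fst := rfl

lemma measurable_flow_fst (A : Space d →L[ℝ] Space d) (s : ℝ) :
    Measurable fun p => (flow A s p).1 := measurable_fst.comp (measurable_flow A s)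

/-! ### Support and Lipschitz bounds for the interpolated scheme. -/

namespace IsScheme

variable {A : Space d →L[ℝ] Space d} {h : ℝ} {e : ℝ≥0∞} {α₀ μ₀ : Measure (Space d)}
  {G : ℕ → ProbabilityMeasure (Space d × Space d)} {R₀ T : ℝ}

lemma schemeKernel_mem_plans (hG : IsScheme A h e α₀ μ₀ G) (t : ℝ) :
    schemeKernel A h G t ∈ plans (schemeCurve A h G t : Measure (Space d)) μ₀ := by
  refine ⟨rfl, ?_⟩
  rw [schemeKernel_apply, ← hG.snd ⌊t / h⌋₊, Measure.snd, Measure.snd,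
    Measure.map_map measurable_snd (measurable_flow _ _)]
  rfl

lemma floor_eq (hh : 0 < h) {k : ℕ} {t : ℝ} (h1 : k * h ≤ t) (h2 : t < (k + 1 : ℕ) * h) :
    ⌊t / h⌋₊ = k := by
  rw [Nat.floor_eq_iff (div_nonneg ((by positivity : (0 : ℝ) ≤ k * h).trans h1) hh.le),
    le_div_iff₀ hh, div_lt_iff₀ hh]
  push_cast at h2
  exact ⟨h1, h2⟩

lemma floor_mul_le (hh : 0 < h) {t : ℝ} (ht : 0 ≤ t) : ⌊t / h⌋₊ * h ≤ t := by
  have := Nat.floor_le (div_nonneg ht hh.le)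
  rwa [le_div_iff₀ hh] at this

lemma lt_floor_add_one_mul (hh : 0 < h) (t : ℝ) : t < (⌊t / h⌋₊ + 1 : ℕ) * h := by
  have := Nat.lt_floor_add_one (t / h)
  rw [div_lt_iff₀ hh] at this
  exact_mod_cast this

/-- Valid on the closed cell: at its right end the floor jumps to `k + 1`, but `step` matches the
first marginals. The plans may jump at grid times while the curve does not. -/
lemma schemeCurve_eq (hG : IsScheme A h e α₀ μ₀ G) (hh : 0 < h) {k : ℕ} {t : ℝ}
    (h1 : k * h ≤ t) (h2 : t ≤ (k + 1 : ℕ) * h) :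
    (schemeCurve A h G t : Measure (Space d))
      = (G k : Measure (Space d × Space d)).map fun p => (flow A (t - k * h) p).1 := by
  have key : ∀ j : ℕ, ⌊t / h⌋₊ = j → (schemeCurve A h G t : Measure (Space d))
      = (G j : Measure (Space d × Space d)).map fun p => (flow A (t - j * h) p).1 := by
    rintro j rfl
    rw [coe_schemeCurve, schemeKernel_apply, Measure.fst,
      Measure.map_map measurable_fst (measurable_flow _ _)]
    rfl
  rcases h2.lt_or_eq with h2 | h2
  · exact key k (floor_eq hh h1 h2)
  · rw [key (k + 1) (floor_eq hh h2.ge (by rw [h2]; push_cast; nlinarith)), h2]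
    have e1 : ((k + 1 : ℕ) : ℝ) * h - (k + 1 : ℕ) * h = 0 := sub_self _
    have e2 : ((k + 1 : ℕ) : ℝ) * h - k * h = h := by push_cast; ring
    rw [e1, e2, flow_zero, ← hG.step k]
    rfl

lemma ae_norm_fst_add_le (hG : IsScheme A h e α₀ μ₀ G) (hh : 0 < h)
    (hα₀ : SupportedInBall α₀ R₀) (hμ₀ : SupportedInBall μ₀ R₀) (k : ℕ) :
    ∀ᵐ p ∂(G k : Measure (Space d × Space d)),
      ‖p.1‖ + R₀ ≤ 2 * R₀ * Real.exp (‖A‖ * (k * h)) := by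
  induction k with
  | zero =>
    filter_upwards [ae_fst_of_mem_plans ⟨hG.init, hG.snd 0⟩
      (ae_norm_le_of_supportedInBall hα₀)] with p hp
    simp
    linarith
  | succ k ih =>
    refine ae_fst_of_mem_plans (p := fun x => ‖x‖ + R₀ ≤ _) ⟨hG.step k, hG.snd (k + 1)⟩ ?_
    rw [ae_map_iff (measurable_flow_fst A h).aemeasurable
      (measurableSet_le (by fun_prop) measurable_const)]
    filter_upwards [ih, ae_snd_of_mem_plans ⟨rfl, hG.snd k⟩
      (ae_norm_le_of_supportedInBall hμ₀)] with p h1 h2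
    refine (norm_flow_fst_add_le A hh.le h2).trans ?_
    calc Real.exp (‖A‖ * h) * (‖p.1‖ + R₀)
        ≤ Real.exp (‖A‖ * h) * (2 * R₀ * Real.exp (‖A‖ * (k * h))) := by gcongr
      _ = 2 * R₀ * Real.exp (‖A‖ * h + ‖A‖ * (k * h)) := by rw [Real.exp_add]; ring
      _ = _ := by
          congr 2
          push_cast
          ring

lemma ae_norm_sub_le (hG : IsScheme A h e α₀ μ₀ G) (hh : 0 < h) (hR₀ : 0 ≤ R₀)
    (hα₀ : SupportedInBall α₀ R₀) (hμ₀ : SupportedInBall μ₀ R₀) {k : ℕ} (hk : k * h ≤ T) :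
    ∀ᵐ p ∂(G k : Measure (Space d × Space d)),
      ‖p.1 - p.2‖ ≤ 2 * R₀ * Real.exp (‖A‖ * T) := by
  filter_upwards [hG.ae_norm_fst_add_le hh hα₀ hμ₀ k, ae_snd_of_mem_plans ⟨rfl, hG.snd k⟩
    (ae_norm_le_of_supportedInBall hμ₀)] with p h1 h2
  calc ‖p.1 - p.2‖ ≤ ‖p.1‖ + ‖p.2‖ := norm_sub_le _ _
    _ ≤ ‖p.1‖ + R₀ := by gcongr
    _ ≤ 2 * R₀ * Real.exp (‖A‖ * (k * h)) := h1
    _ ≤ _ := by gcongr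

lemma supportedInBall (hG : IsScheme A h e α₀ μ₀ G) (hh : 0 < h) (hR₀ : 0 ≤ R₀)
    (hα₀ : SupportedInBall α₀ R₀) (hμ₀ : SupportedInBall μ₀ R₀) {t : ℝ} (ht : t ∈ Icc 0 T) :
    SupportedInBall (schemeCurve A h G t : Measure (Space d))
      (2 * R₀ * Real.exp (‖A‖ * T)) := by
  have h1 := floor_mul_le hh ht.1
  have h2 := (lt_floor_add_one_mul hh t).le
  refine supportedInBall_of_ae ?_
  rw [hG.schemeCurve_eq hh h1 h2, ae_map_iff (measurable_flow_fst A _).aemeasurable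
      (measurableSet_le (by fun_prop) measurable_const)]
  filter_upwards [hG.ae_norm_fst_add_le hh hα₀ hμ₀ ⌊t / h⌋₊, ae_snd_of_mem_plans
    ⟨rfl, hG.snd ⌊t / h⌋₊⟩ (ae_norm_le_of_supportedInBall hμ₀)] with p hp1 hp2
  have h3 := norm_flow_fst_add_le A (s := t - ⌊t / h⌋₊ * h) (by linarith) hp2
  calc ‖(flow A (t - ⌊t / h⌋₊ * h) p).1‖
      ≤ Real.exp (‖A‖ * (t - ⌊t / h⌋₊ * h)) * (‖p.1‖ + R₀) := by linarith
    _ ≤ Real.exp (‖A‖ * (t - ⌊t / h⌋₊ * h)) * (2 * R₀ * Real.exp (‖A‖ * (⌊t / h⌋₊ * h))) := by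
        gcongr
    _ = 2 * R₀ * Real.exp (‖A‖ * (t - ⌊t / h⌋₊ * h) + ‖A‖ * (⌊t / h⌋₊ * h)) := by
        rw [Real.exp_add]; ring
    _ = 2 * R₀ * Real.exp (‖A‖ * t) := by congr 2; ring
    _ ≤ _ := by gcongr; exact ht.2

/-- Couple the two times by following the same pair `p`: its first component moves at speed at most
`‖A‖ exp (‖A‖ T)` times `‖p.1 - p.2‖`. -/
lemma W2_cell_le (hG : IsScheme A h e α₀ μ₀ G) (hh : 0 < h) (hR₀ : 0 ≤ R₀)
    (hα₀ : SupportedInBall α₀ R₀) (hμ₀ : SupportedInBall μ₀ R₀) {k : ℕ} {s t : ℝ}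
    (hs : s ∈ Icc (k * h) ((k + 1 : ℕ) * h)) (ht : t ∈ Icc (k * h) ((k + 1 : ℕ) * h))
    (hsT : s ≤ T) (htT : t ≤ T) :
    W2 (schemeCurve A h G s : Measure (Space d)) (schemeCurve A h G t)
      ≤ ENNReal.ofReal (‖A‖ * Real.exp (‖A‖ * T) * (2 * R₀ * Real.exp (‖A‖ * T)) * |s - t|) := by
  have hk : (0 : ℝ) ≤ k * h := by positivity
  rw [hG.schemeCurve_eq hh hs.1 hs.2, hG.schemeCurve_eq hh ht.1 ht.2]
  refine (W2_map_le _ (measurable_flow_fst A _) (measurable_flow_fst A _)).trans ?_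
  set c := ‖A‖ * Real.exp (‖A‖ * T) * (2 * R₀ * Real.exp (‖A‖ * T)) * |s - t| with hc
  have hc0 : 0 ≤ c := by positivity
  calc eLpNorm (fun p => (flow A (s - k * h) p).1 - (flow A (t - k * h) p).1) 2 (G k)
      ≤ eLpNorm (fun _ : Space d × Space d => c) 2 (G k) := by
        refine eLpNorm_mono_ae ?_
        filter_upwards [hG.ae_norm_sub_le hh hR₀ hα₀ hμ₀ (hs.1.trans hsT)] with p hp
        rw [Real.norm_of_nonneg hc0]
        have h1 := norm_flow_fst_sub_le A (T := T) (s := s - k * h) (s' := t - k * h)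
          ⟨by linarith [hs.1], by linarith⟩ ⟨by linarith [ht.1], by linarith⟩ p
        rw [sub_sub_sub_cancel_right] at h1
        refine h1.trans ?_
        rw [hc]
        calc ‖A‖ * Real.exp (‖A‖ * T) * |s - t| * ‖p.1 - p.2‖
            ≤ ‖A‖ * Real.exp (‖A‖ * T) * |s - t| * (2 * R₀ * Real.exp (‖A‖ * T)) := by gcongr
          _ = _ := by ring
    _ = ENNReal.ofReal c := by
        rw [eLpNorm_const _ (by norm_num) (IsProbabilityMeasure.ne_zero _), measure_univ,
          ENNReal.one_rpow, mul_one, Real.enorm_of_nonneg hc0]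

lemma W2_le_of_le (hG : IsScheme A h e α₀ μ₀ G) (hh : 0 < h) (hR₀ : 0 ≤ R₀)
    (hα₀ : SupportedInBall α₀ R₀) (hμ₀ : SupportedInBall μ₀ R₀) (k : ℕ) {s t : ℝ}
    (hs : 0 ≤ s) (hst : s ≤ t) (ht : t ≤ k * h) (htT : t ≤ T) :
    W2 (schemeCurve A h G s : Measure (Space d)) (schemeCurve A h G t)
      ≤ ENNReal.ofReal
        (‖A‖ * Real.exp (‖A‖ * T) * (2 * R₀ * Real.exp (‖A‖ * T)) * (t - s)) := by
  induction k generalizing s t with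
  | zero =>
    have h0 : s = t := by
      rw [Nat.cast_zero, zero_mul] at ht
      linarith
    subst h0
    rw [W2_self]
    exact zero_le
  | succ k ih =>
    rcases le_total t (k * h) with h1 | h1
    · exact ih hs hst h1 htT
    have cell : ∀ s', k * h ≤ s' → s' ≤ t →
        W2 (schemeCurve A h G s' : Measure (Space d)) (schemeCurve A h G t) ≤ ENNReal.ofReal
        (‖A‖ * Real.exp (‖A‖ * T) * (2 * R₀ * Real.exp (‖A‖ * T)) * (t - s')) := by
      intro s' h2 h3
      have := hG.W2_cell_le hh hR₀ hα₀ hμ₀ ⟨h2, h3.trans ht⟩ ⟨h1, ht⟩ (h3.trans htT) htT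
      rwa [abs_sub_comm, abs_of_nonneg (by linarith)] at this
    rcases le_total (k * h) s with h2 | h2
    · exact cell s h2 hst
    · refine (W2_triangle _ (schemeCurve A h G (k * h) : Measure (Space d)) _).trans
        ((add_le_add (ih hs h2 le_rfl (h1.trans htT)) (cell _ le_rfl h1)).trans_eq ?_)
      have h3 : 0 ≤ k * h - s := by linarith
      have h4 : 0 ≤ t - k * h := by linarith
      rw [← ENNReal.ofReal_add (by positivity) (by positivity)]
      congr 1
      ring

lemma W2_le (hG : IsScheme A h e α₀ μ₀ G) (hh : 0 < h) (hR₀ : 0 ≤ R₀)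
    (hα₀ : SupportedInBall α₀ R₀) (hμ₀ : SupportedInBall μ₀ R₀) {s t : ℝ}
    (hs : s ∈ Icc 0 T) (ht : t ∈ Icc 0 T) :
    W2 (schemeCurve A h G s : Measure (Space d)) (schemeCurve A h G t)
      ≤ ENNReal.ofReal
        (‖A‖ * Real.exp (‖A‖ * T) * (2 * R₀ * Real.exp (‖A‖ * T)) * |s - t|) := by
  rcases le_total s t with hst | hst
  · rw [abs_sub_comm, abs_of_nonneg (by linarith)]
    exact hG.W2_le_of_le hh hR₀ hα₀ hμ₀ _ hs.1 hst (lt_floor_add_one_mul hh t).le ht.2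
  · rw [abs_of_nonneg (by linarith), W2_comm]
    exact hG.W2_le_of_le hh hR₀ hα₀ hμ₀ _ ht.1 hst (lt_floor_add_one_mul hh s).le hs.2

end IsScheme

/-! ### Near optimality and exact weak equation for the interpolated scheme. -/

namespace IsScheme

variable {A : Space d →L[ℝ] Space d} {h : ℝ} {α₀ μ₀ : Measure (Space d)}
  {G : ℕ → ProbabilityMeasure (Space d × Space d)} {R₀ T : ℝ}

/-- Three errors add up: the motion of the curve since the last grid time, the slack `e` of the
chosen plan, and the stretching of `x - y` by the flow. The stretching is multiplicative and becomes
additive through the bound `M` on `W`. All vanish with `h` and `e`. -/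
lemma quadCost_le [IsProbabilityMeasure μ₀] {e : ℝ} (he : 0 ≤ e)
    (hG : IsScheme A h (ENNReal.ofReal e) α₀ μ₀ G) (hh : 0 < h) (hR₀ : 0 ≤ R₀)
    (hα₀ : SupportedInBall α₀ R₀) (hμ₀ : SupportedInBall μ₀ R₀) {t : ℝ} (ht : t ∈ Icc 0 T) :
    quadCost (schemeKernel A h G t) ≤ (W2 (schemeCurve A h G t : Measure (Space d)) μ₀
      + ENNReal.ofReal ((Real.exp (‖A‖ * h) - 1) * (2 * R₀ * Real.exp (‖A‖ * T) + R₀)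
        + Real.exp (‖A‖ * h) * (‖A‖ * Real.exp (‖A‖ * T) * (2 * R₀ * Real.exp (‖A‖ * T)) * h
          + e))) ^ 2 := by
  set k := ⌊t / h⌋₊ with hk
  set V := ‖A‖ * Real.exp (‖A‖ * T) * (2 * R₀ * Real.exp (‖A‖ * T)) with hV
  set M := 2 * R₀ * Real.exp (‖A‖ * T) + R₀ with hM
  set W := W2 (schemeCurve A h G t : Measure (Space d)) μ₀ with hW
  have h1 : k * h ≤ t := floor_mul_le hh ht.1
  have h2 : t ≤ (k + 1 : ℕ) * h := (lt_floor_add_one_mul hh t).le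
  have h2' : t - k * h ≤ h := by
    push_cast at h2
    linarith
  have hk0 : (0 : ℝ) ≤ k * h := by positivity
  have hV0 : 0 ≤ V := by positivity
  have hM0 : 0 ≤ M := by positivity
  have hexp : 0 ≤ Real.exp (‖A‖ * h) - 1 := by
    have := Real.one_le_exp (show 0 ≤ ‖A‖ * h by positivity)
    linarith
  have hWM : W ≤ ENNReal.ofReal M :=
    W2_le_of_supportedInBall (hG.supportedInBall hh hR₀ hα₀ hμ₀ ht) hμ₀
  have hGk : (G k : Measure (Space d × Space d)).fst = schemeCurve A h G (k * h) := by
    rw [hG.schemeCurve_eq hh le_rfl (by push_cast; nlinarith), sub_self, flow_zero]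
    rfl
  have hWk : W2 (G k : Measure (Space d × Space d)).fst μ₀ ≤ ENNReal.ofReal (V * h) + W := by
    rw [hGk]
    refine (W2_triangle _ (schemeCurve A h G t : Measure (Space d)) _).trans ?_
    gcongr
    refine (hG.W2_le hh hR₀ hα₀ hμ₀ (s := k * h) ⟨hk0, h1.trans ht.2⟩ ht).trans ?_
    refine ENNReal.ofReal_le_ofReal ?_
    rw [abs_sub_comm, abs_of_nonneg (by linarith)]
    gcongr
  have hN : eLpNorm (fun p : Space d × Space d => p.1 - p.2) 2 (schemeKernel A h G t)
      ≤ ENNReal.ofReal (Real.exp (‖A‖ * h))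
        * eLpNorm (fun p : Space d × Space d => p.1 - p.2) 2 (G k) := by
    rw [schemeKernel_apply, eLpNorm_map_measure (by fun_prop) (measurable_flow _ _).aemeasurable]
    refine eLpNorm_le_mul_eLpNorm_of_ae_le_mul (.of_forall fun p => ?_) 2
    refine (norm_flow_sub_le A (by linarith) p).trans ?_
    gcongr
  rw [quadCost_eq_eLpNorm_sq]
  gcongr
  refine hN.trans ?_
  calc ENNReal.ofReal (Real.exp (‖A‖ * h))
        * eLpNorm (fun p : Space d × Space d => p.1 - p.2) 2 (G k)
      ≤ ENNReal.ofReal (Real.exp (‖A‖ * h))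
        * (ENNReal.ofReal (V * h) + W + ENNReal.ofReal e) := by
        gcongr
        exact (hG.opt k).trans (by gcongr)
    _ = ENNReal.ofReal (Real.exp (‖A‖ * h)) * W
        + ENNReal.ofReal (Real.exp (‖A‖ * h)) * (ENNReal.ofReal (V * h) + ENNReal.ofReal e) := by
        ring
    _ = (1 + ENNReal.ofReal (Real.exp (‖A‖ * h) - 1)) * W
        + ENNReal.ofReal (Real.exp (‖A‖ * h) * (V * h + e)) := by
        rw [ENNReal.ofReal_mul (Real.exp_pos _).le, ENNReal.ofReal_add (mul_nonneg hV0 hh.le) he,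
          ← ENNReal.ofReal_one, ← ENNReal.ofReal_add zero_le_one hexp, add_sub_cancel]
    _ ≤ W + (ENNReal.ofReal (Real.exp (‖A‖ * h) - 1) * ENNReal.ofReal M
        + ENNReal.ofReal (Real.exp (‖A‖ * h) * (V * h + e))) := by
        rw [add_mul, one_mul, add_assoc]
        gcongr
    _ = _ := by
        rw [← ENNReal.ofReal_mul hexp, ← ENNReal.ofReal_add (by positivity) (by positivity)]

/-- Within a cell the plans are push-forwards of one fixed plan by the flow, so the equation holds
there exactly. The boundary terms telescope over the `N` cells tiling `[0, T]`. -/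
lemma isWeakCurve [hT : Fact (0 < T)] {e : ℝ≥0∞} (hG : IsScheme A h e α₀ μ₀ G) (hh : 0 < h)
    (hR₀ : 0 ≤ R₀) (hα₀ : SupportedInBall α₀ R₀) (hμ₀ : SupportedInBall μ₀ R₀) {N : ℕ}
    (hN : N * h = T) :
    IsWeakCurve T R₀ A α₀ (schemeCurve A h G) (schemeKernel A h G) := by
  have hsupp : ∀ t ∈ Icc 0 T, SupportedInBall (schemeCurve A h G t : Measure (Space d))
      (2 * R₀ * Real.exp (‖A‖ * T)) := fun t ht => hG.supportedInBall hh hR₀ hα₀ hμ₀ ht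
  have hgrid : ∀ k : ℕ, (schemeCurve A h G (k * h) : Measure (Space d))
      = (G k : Measure (Space d × Space d)).map Prod.fst := fun k => by
    rw [hG.schemeCurve_eq hh le_rfl (by push_cast; nlinarith), sub_self, flow_zero]
    rfl
  have hinit : (schemeCurve A h G 0 : Measure (Space d)) = α₀ := by
    have := hgrid 0
    rw [Nat.cast_zero, zero_mul] at this
    rw [this, ← hG.init]
    rfl
  have hplan : ∀ᵐ t ∂timeMeasure T, schemeKernel A h G t ∈
      plans (schemeCurve A h G t : Measure (Space d)) μ₀ :=
    .of_forall hG.schemeKernel_mem_plans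
  refine ⟨fun t ht => ?_, hinit, hsupp, (weakEquation_iff hsupp hμ₀ hplan).2 fun f hf => ?_⟩
  · have hlim : Tendsto (fun s => ENNReal.ofReal
        (‖A‖ * Real.exp (‖A‖ * T) * (2 * R₀ * Real.exp (‖A‖ * T)) * |s - t|))
        (𝓝[Icc 0 T] t) (𝓝 0) := by
      have hc : Continuous fun s => ENNReal.ofReal
        (‖A‖ * Real.exp (‖A‖ * T) * (2 * R₀ * Real.exp (‖A‖ * T)) * |s - t|) :=
        ENNReal.continuous_ofReal.comp (by fun_prop)
      have := hc.tendsto t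
      simp only [sub_self, abs_zero, mul_zero, ENNReal.ofReal_zero] at this
      exact this.mono_left nhdsWithin_le_nhds
    refine tendsto_of_tendsto_of_tendsto_of_le_of_le' tendsto_const_nhds hlim
      (.of_forall fun _ => zero_le) ?_
    filter_upwards [self_mem_nhdsWithin] with s hs
    exact hG.W2_le hh hR₀ hα₀ hμ₀ hs ht
  · have hint := integrable_of_isCompact (isCompact_carrier T (2 * R₀ * Real.exp (‖A‖ * T)) R₀)
      (measure_compl_carrier hsupp hμ₀ hplan) (continuous_transportDeriv (A := A) hf)
    have hg : IntegrableOn (fun t => ∫ p, transportDeriv A f (t, p) ∂(schemeKernel A h G t))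
        (Icc 0 T) := by
      have := integrable_integral_of_compProd hint
      rwa [timeMeasure, integrable_smul_measure (ENNReal.inv_ne_zero.2 ENNReal.ofReal_ne_top)
        (ENNReal.inv_ne_top.2 (by simpa using hT.out))] at this
    have hle : ∀ k < N, ((k + 1 : ℕ) : ℝ) * h ≤ T := fun k hk => by
      rw [← hN]
      gcongr
      exact hk
    have hkk : ∀ k : ℕ, (k : ℝ) * h ≤ (k + 1 : ℕ) * h := fun k => by
      gcongr
      exact Nat.le_succ k
    have hcell : ∀ k < N, ∫ t in (k * h)..((k + 1 : ℕ) * h),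
        ∫ p, transportDeriv A f (t, p) ∂(schemeKernel A h G t)
        = (∫ x, f ((k + 1 : ℕ) * h, x) ∂(schemeCurve A h G ((k + 1 : ℕ) * h) : Measure (Space d)))
          - ∫ x, f (k * h, x) ∂(schemeCurve A h G (k * h) : Measure (Space d)) := by
      intro k hk
      set K : Set (Space d × Space d) :=
        Metric.closedBall 0 (2 * R₀ * Real.exp (‖A‖ * (k * h))) ×ˢ Metric.closedBall 0 R₀ with hK
      have hKc : IsCompact K := (isCompact_closedBall _ _).prod (isCompact_closedBall _ _)
      have hKG : (G k : Measure (Space d × Space d)) Kᶜ = 0 := by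
        have : ∀ᵐ p ∂(G k : Measure (Space d × Space d)), p ∈ K := by
          filter_upwards [hG.ae_norm_fst_add_le hh hα₀ hμ₀ k, ae_snd_of_mem_plans ⟨rfl, hG.snd k⟩
            (ae_norm_le_of_supportedInBall hμ₀)] with p h1 h2
          refine ⟨?_, by simpa using h2⟩
          rw [mem_closedBall_zero_iff]
          linarith
        exact this
      have hfc : ∀ c : ℝ, Continuous fun x => f (c, x) := fun c =>
        hf.continuous.comp (by fun_prop)
      have e1 := intervalIntegral_transportDeriv_flow A hf hKc hKG (k * h) ((k + 1 : ℕ) * h)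
      have e2 : (∫ x, f ((k + 1 : ℕ) * h, x)
            ∂(schemeCurve A h G ((k + 1 : ℕ) * h) : Measure (Space d)))
          = ∫ p, f ((k + 1 : ℕ) * h, (flow A ((k + 1 : ℕ) * h - k * h) p).1)
            ∂(G k : Measure (Space d × Space d)) := by
        rw [hG.schemeCurve_eq hh (hkk k) le_rfl,
          integral_map (measurable_flow_fst A _).aemeasurable
            (hfc _).aestronglyMeasurable]
      have e3 : (∫ x, f (k * h, x) ∂(schemeCurve A h G (k * h) : Measure (Space d)))
          = ∫ p, f (k * h, p.1) ∂(G k : Measure (Space d × Space d)) := by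
        rw [hgrid, integral_map measurable_fst.aemeasurable
          (hfc _).aestronglyMeasurable]
      -- Half-open cells are needed because the floor equals `k` on `[k h, (k + 1) h)` and jumps at
      -- the right end.
      rw [e2, e3, ← e1, intervalIntegral.integral_of_le (hkk k),
        intervalIntegral.integral_of_le (hkk k), ← integral_Ico_eq_integral_Ioc,
        ← integral_Ico_eq_integral_Ioc]
      refine setIntegral_congr_fun measurableSet_Ico fun t ht => ?_
      have hc : Continuous fun p => transportDeriv A f (t, p) :=
        (continuous_transportDeriv hf).comp (by fun_prop)
      rw [schemeKernel_apply, floor_eq hh ht.1 ht.2, integral_map (measurable_flow _ _).aemeasurable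
        hc.aestronglyMeasurable]
    rw [Measure.integral_compProd hint, ← intervalIntegral_eq_timeMeasure hT.out, ← hinit]
    have hsum := intervalIntegral.sum_integral_adjacent_intervals (μ := volume)
      (f := fun t => ∫ p, transportDeriv A f (t, p) ∂(schemeKernel A h G t))
      (a := fun k : ℕ => k * h) (n := N) fun k hk => by
        refine IntegrableOn.intervalIntegrable (hg.mono_set ?_)
        rw [uIcc_of_le (hkk k)]
        exact Icc_subset_Icc (by positivity) (hle k hk)
    rw [Finset.sum_congr rfl fun k hk => hcell k (Finset.mem_range.1 hk),
      Finset.sum_range_sub (fun k : ℕ =>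
        ∫ x, f (k * h, x) ∂(schemeCurve A h G (k * h) : Measure (Space d)))] at hsum
    simp only [Nat.cast_zero, zero_mul, hN] at hsum
    exact hsum.symm

end IsScheme

/-! ### Limit of the time-stepping scheme. -/

/-- Equi-Lipschitz curves converging pointwise in Wasserstein distance converge uniformly. -/
lemma tendsto_uniformW2_of_lipschitz {ι : Type*} {l : Filter ι} {T V : ℝ} (hV : 0 ≤ V)
    {αs : ι → ℝ → ProbabilityMeasure (Space d)} {α : ℝ → ProbabilityMeasure (Space d)}
    (hs : ∀ i, ∀ s ∈ Icc 0 T, ∀ t ∈ Icc 0 T,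
      W2 (αs i s : Measure (Space d)) (αs i t) ≤ ENNReal.ofReal (V * |s - t|))
    (hα : ∀ s ∈ Icc 0 T, ∀ t ∈ Icc 0 T,
      W2 (α s : Measure (Space d)) (α t) ≤ ENNReal.ofReal (V * |s - t|))
    (h : ∀ t ∈ Icc 0 T, Tendsto (fun i => W2 (αs i t : Measure (Space d)) (α t)) l (𝓝 0)) :
    Tendsto (fun i => uniformW2 T (αs i) α) l (𝓝 0) := by
  rw [ENNReal.tendsto_nhds_zero]
  intro ε hε
  -- A finite tolerance below `ε`, which may itself be infinite.
  obtain ⟨η, hη0, hηε⟩ := exists_between hε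
  have hηt : η ≠ ∞ := ne_top_of_lt hηε
  set r := η.toReal with hr
  have hr0 : 0 < r := ENNReal.toReal_pos hη0.ne' hηt
  obtain ⟨u, huT, huf, hcov⟩ := isCompact_Icc.finite_cover_balls (s := Icc 0 T)
    (e := r / (3 * (V + 1))) (by positivity)
  have hpt : ∀ᶠ i in l, ∀ c ∈ u, W2 (αs i c : Measure (Space d)) (α c) ≤ ENNReal.ofReal (r / 3) :=
    (eventually_all_finite huf).2 fun c hc =>
      ENNReal.tendsto_nhds_zero.1 (h c (huT hc)) _ (by simpa using hr0)
  filter_upwards [hpt] with i hi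
  refine iSup₂_le fun t ht => ?_
  obtain ⟨c, hc, htc⟩ := mem_iUnion₂.1 (hcov ht)
  have hVd : V * |t - c| ≤ r / 3 := by
    rw [Metric.mem_ball, Real.dist_eq, lt_div_iff₀ (by positivity)] at htc
    nlinarith [abs_nonneg (t - c)]
  calc W2 (αs i t : Measure (Space d)) (α t)
      ≤ W2 (αs i t : Measure (Space d)) (αs i c) + (W2 (αs i c : Measure (Space d)) (α c)
        + W2 (α c : Measure (Space d)) (α t)) :=
        (W2_triangle _ (αs i c : Measure (Space d)) _).trans
          (add_le_add_right (W2_triangle _ (α c : Measure (Space d)) _) _)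
    _ ≤ ENNReal.ofReal (r / 3) + (ENNReal.ofReal (r / 3) + ENNReal.ofReal (r / 3)) := by
        gcongr
        · exact (hs i t ht c (huT hc)).trans (ENNReal.ofReal_le_ofReal hVd)
        · exact hi c hc
        · rw [W2_comm]
          exact (hα t ht c (huT hc)).trans (ENNReal.ofReal_le_ofReal hVd)
    _ = ENNReal.ofReal r := by
        rw [← ENNReal.ofReal_add (by positivity) (by positivity),
          ← ENNReal.ofReal_add (by positivity) (by positivity)]
        congr 1
        ring
    _ = η := ENNReal.ofReal_toReal hηt
    _ ≤ ε := hηε.le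

/-- Schemes with time step and slack tending to `0` converge along an ultrafilter, uniformly by
equi-Lipschitz continuity. -/
theorem exists_isSGSolution {T R₀ : ℝ} [hT : Fact (0 < T)] (hR₀ : 0 ≤ R₀)
    (A : Space d →L[ℝ] Space d) (α₀ μ₀ : ProbabilityMeasure (Space d))
    (hα₀ : SupportedInBall (α₀ : Measure (Space d)) R₀)
    (hμ₀ : SupportedInBall (μ₀ : Measure (Space d)) R₀) :
    ∃ α, IsSGSolution T R₀ A (α₀ : Measure (Space d)) μ₀ α := by
  set R := 2 * R₀ * Real.exp (‖A‖ * T) with hR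
  set V := ‖A‖ * Real.exp (‖A‖ * T) * R with hV
  have hV0 : 0 ≤ V := by positivity
  have hT0 := hT.out
  -- Both the slack and, times `T`, the step, so that exactly `n + 1` steps fill `[0, T]`.
  set e : ℕ → ℝ := fun n => 1 / (n + 1) with he
  have he0 : ∀ n, 0 < e n := fun n => Nat.one_div_pos_of_nat
  have hhn : ∀ n, 0 < T * e n := fun n => mul_pos hT0 (he0 n)
  choose G hG using fun n : ℕ => exists_isScheme A (T * e n) (e := ENNReal.ofReal (e n))
    (by simpa using he0 n) α₀ μ₀
  have hcurve : ∀ n, IsWeakCurve T R₀ A (α₀ : Measure (Space d)) (schemeCurve A (T * e n) (G n))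
      (schemeKernel A (T * e n) (G n)) := fun n =>
    (hG n).isWeakCurve (hhn n) hR₀ hα₀ hμ₀ (N := n + 1) (by
      rw [he]
      push_cast
      field_simp)
  -- An ultrafilter gives limits at all times at once, and for the plans as well, without extracting
  -- subsequences.
  set l : Filter ℕ := (hyperfilter ℕ : Filter ℕ) with hl
  have hl_le : l ≤ atTop := Nat.hyperfilter_le_atTop
  have hlim : ∀ t, ∃ m : ProbabilityMeasure (Space d), t ∈ Icc 0 T →
      SupportedInBall (m : Measure (Space d)) R ∧
      Tendsto (fun n => schemeCurve A (T * e n) (G n) t) l (𝓝 m) := by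
    intro t
    by_cases ht : t ∈ Icc 0 T
    · obtain ⟨m, hm, hle⟩ := (isCompact_setOf_probabilityMeasure_compl_eq_zero
        (isCompact_closedBall (0 : Space d) R)).ultrafilter_le_nhds
        ((hyperfilter ℕ).map fun n => schemeCurve A (T * e n) (G n) t) (by
          rw [Ultrafilter.coe_map, le_principal_iff, mem_map]
          exact univ_mem' fun n => (hcurve n).support t ht)
      exact ⟨m, fun _ => ⟨hm, hle⟩⟩
    · exact ⟨α₀, fun h => absurd h ht⟩
  choose α hα using hlim
  have hptw : ∀ t ∈ Icc 0 T, Tendsto (fun n =>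
      W2 (schemeCurve A (T * e n) (G n) t : Measure (Space d)) (α t)) l (𝓝 0) := fun t ht =>
    tendsto_W2_of_tendsto (fun n => (hcurve n).support t ht) (hα t ht).1 (hα t ht).2
  have hLip : ∀ n, ∀ s ∈ Icc 0 T, ∀ t ∈ Icc 0 T,
      W2 (schemeCurve A (T * e n) (G n) s : Measure (Space d)) (schemeCurve A (T * e n) (G n) t)
        ≤ ENNReal.ofReal (V * |s - t|) := fun n s hs t ht =>
    (hG n).W2_le (hhn n) hR₀ hα₀ hμ₀ hs ht
  have hLipα : ∀ s ∈ Icc 0 T, ∀ t ∈ Icc 0 T,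
      W2 (α s : Measure (Space d)) (α t) ≤ ENNReal.ofReal (V * |s - t|) := by
    intro s hs t ht
    have h1 := (hptw s hs).add ((tendsto_const_nhds (x := ENNReal.ofReal (V * |s - t|))).add
      (hptw t ht))
    rw [add_zero, zero_add] at h1
    refine ge_of_tendsto' h1 fun n => ?_
    refine (W2_triangle _ (schemeCurve A (T * e n) (G n) s : Measure (Space d)) _).trans ?_
    rw [W2_comm]
    gcongr
    refine (W2_triangle _ (schemeCurve A (T * e n) (G n) t : Measure (Space d)) _).trans ?_
    gcongr
    exact hLip n s hs t ht
  have hu := tendsto_uniformW2_of_lipschitz hV0 hLip hLipα hptw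
  obtain ⟨Γ, -, hΓ⟩ := (isCompact_setOf_probabilityMeasure_compl_eq_zero
    (isCompact_carrier (d := d) T R R₀)).ultrafilter_le_nhds
    ((hyperfilter ℕ).map fun n => jointMeasure T (schemeKernel A (T * e n) (G n))) (by
      rw [Ultrafilter.coe_map, le_principal_iff, mem_map]
      exact univ_mem' fun n => measure_compl_carrier (hcurve n).support hμ₀
        (.of_forall (hG n).schemeKernel_mem_plans))
  refine ⟨α, _, isSGSolutionWith_of_tendsto (l := l) hμ₀ hcurve
    (fun n => .of_forall (hG n).schemeKernel_mem_plans) (fun δ hδ => ?_) hu hΓ⟩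
  -- The error of `IsScheme.quadCost_le` is a continuous function of `e n` vanishing at `0`.
  have herr : Tendsto (fun n => (Real.exp (‖A‖ * (T * e n)) - 1) * (R + R₀)
      + Real.exp (‖A‖ * (T * e n)) * (V * (T * e n) + e n)) atTop (𝓝 0) := by
    have hc : Continuous fun x : ℝ => (Real.exp (‖A‖ * (T * x)) - 1) * (R + R₀)
      + Real.exp (‖A‖ * (T * x)) * (V * (T * x) + x) := by fun_prop
    have h1 := (hc.tendsto 0).comp (tendsto_one_div_add_atTop_nhds_zero_nat (𝕜 := ℝ))
    simpa [he, Function.comp_def] using! h1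
  filter_upwards [hl_le (herr.eventually_le_const (show (0 : ℝ) < δ by exact_mod_cast hδ))]
    with n hn
  filter_upwards [ae_timeMeasure_mem] with t ht
  refine ((hG n).quadCost_le (he0 n).le (hhn n) hR₀ hα₀ hμ₀ ht).trans ?_
  refine le_add_right ?_
  gcongr
  rw [← ENNReal.ofReal_coe_nnreal]
  exact ENNReal.ofReal_le_ofReal hn

end SemiGeo

theorem theorem4p1 (d : ℕ) (A : Matrix (Fin d) (Fin d) ℝ) (T R₀ : ℝ) (hT : 0 < T) (hR₀ : 0 < R₀)
    (α₀ μ₀ : ProbabilityMeasure (SemiGeo.Space d))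
    (hα₀ : SemiGeo.SupportedInBall (α₀ : Measure (SemiGeo.Space d)) R₀)
    (hμ₀ : SemiGeo.SupportedInBall (μ₀ : Measure (SemiGeo.Space d)) R₀) :
    -- cluster points of entropic weak solutions are weak solutions
    (∀ (ε : ℕ → ℝ) (αs : ℕ → ℝ → ProbabilityMeasure (SemiGeo.Space d))
        (α : ℝ → ProbabilityMeasure (SemiGeo.Space d)),
      (∀ n, 0 < ε n) → Tendsto ε atTop (𝓝 0) →
      (∀ n, SemiGeo.IsEntropicSolution (ε n) T R₀ (Matrix.toEuclideanCLM (𝕜 := ℝ) A)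
        α₀ μ₀ (αs n)) →
      Tendsto (fun n => SemiGeo.uniformW2 T (αs n) α) atTop (𝓝 0) →
      SemiGeo.IsSGSolution T R₀ (Matrix.toEuclideanCLM (𝕜 := ℝ) A) α₀ μ₀ α) ∧
    -- the entropic plans converge, along a subsequence, to optimal plans of the limit solution
    (∀ (ε : ℕ → ℝ) (αs : ℕ → ℝ → ProbabilityMeasure (SemiGeo.Space d))
        (γs : ℕ → Kernel ℝ (SemiGeo.Space d × SemiGeo.Space d))
        (α : ℝ → ProbabilityMeasure (SemiGeo.Space d)),
      (∀ n, 0 < ε n) → Tendsto ε atTop (𝓝 0) →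
      (∀ n, SemiGeo.IsEntropicSolutionWith (ε n) T R₀ (Matrix.toEuclideanCLM (𝕜 := ℝ) A)
        α₀ μ₀ (αs n) (γs n)) →
      Tendsto (fun n => SemiGeo.uniformW2 T (αs n) α) atTop (𝓝 0) →
      ∃ (φ : ℕ → ℕ) (γ : Kernel ℝ (SemiGeo.Space d × SemiGeo.Space d)),
        StrictMono φ ∧ SemiGeo.PlansConverge T (fun n => γs (φ n)) γ ∧
        SemiGeo.IsSGSolutionWith T R₀ (Matrix.toEuclideanCLM (𝕜 := ℝ) A) α₀ μ₀ α γ) ∧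
    -- existence of weak solutions
    (∃ α : ℝ → ProbabilityMeasure (SemiGeo.Space d),
      SemiGeo.IsSGSolution T R₀ (Matrix.toEuclideanCLM (𝕜 := ℝ) A) α₀ μ₀ α) := by
  have : Fact (0 < T) := ⟨hT⟩
  refine ⟨fun ε αs α _ hε hs hu => ?_, fun ε αs γs α _ hε hs hu =>
    SemiGeo.exists_subseq_isSGSolutionWith hμ₀ hε hs hu,
    SemiGeo.exists_isSGSolution hR₀.le _ α₀ μ₀ hα₀ hμ₀⟩
  choose γs hγs using hs
  obtain ⟨-, γ, -, -, hγ⟩ := SemiGeo.exists_subseq_isSGSolutionWith hμ₀ hε hγs hu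
  exact ⟨γ, hγ⟩
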